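/- **Definitions.** All graphs are finite and directed, and loops are allowed. For graphs $G, H$, the Cartesian product $G \,\square\, H$ has vertex set $V(G)\times V(H)$ and an edge from $(v_1,u_1)$ to $(v_2,u_2)$ if and only if either $v_1=v_2$ and $(u_1,u_2)\in E(H)$, or $u_1=u_2$ and $(v_1,v_2)\in E(G)$. The tensor product $G\times H$ has the same vertex set and an edge from $(v_1,u_1)$ to $(v_2,u_2)$ if and only if $(v_1,v_2)\in E(G)$ and $(u_1,u_2)\in E(H)$. The union $G\cup H$ has vertex set $V(G)\cup V(H)$ and edge set $E(G)\cup E(H)$. Vertices of iterated products are regarded as flattened tuples. A *factored graph* $G=f(G_1,\dots,G_m)$ is given by a formula $f$ built with these three binary operations from explicitly given input graphs; it has *complexity $(n,k)$* if $f$ has $k-1$ operations and every input graph has at most $n$ vertices (the vertices of the input graphs being named, without loss of generality, by numbers in $\{0,\dots,nk-1\}$). *Reachability on factored graphs* is the problem: given a factored graph $G$ (by its formula and its input graphs) and two vertices $s,t$ of $G$, decide whether $G$ has a directed path from $s$ to $t$. It is *fixed parameter tractable* if some algorithm solves it on factored graphs of complexity $(n,k)$ in time $O(g(k)\,n^{C})$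 for some function $g$ and some constant $C$ independent of $k$. Algorithms are deterministic multi-tape Turing machines, and time is the number of steps. The problem $k\mathbf{OV}$ is: given $k$ families $A_1,\dots,A_k$ of $n\ge 1$ vectors in $\{0,1\}^d$, $d\ge1$, decide whether there are $a_1\in A_1,\dots,a_k\in A_k$ with $a_1[\ell]\cdot a_2[\ell]\cdots a_k[\ell]=0$ for all $\ell\in\{1,\dots,d\}$. The *$k\mathbf{OV}$ conjecture* states that for no fixed $k\ge 2$ and no $\varepsilon>0$ is there an algorithm that solves $k\mathbf{OV}$ in time $O(n^{k-\varepsilon}\,\mathrm{poly}(d))$. **Theorem (Conditional Hardness of Reachability).** Assume the $k\mathbf{OV}$ conjecture. Then reachability on factored graphs is not fixed parameter tractable. Moreover, reachability on factored graphs of complexity $(n,k)$ requires $n^{\Omega(k^{1/3})}$ time: there are constants $c>0$ and $k_0$ such that for every fixed $k\ge k_0$ no algorithm solves reachability on factored graphs of complexity $(n,k)$ in time $O(n^{c\,k^{1/3}})$. -/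

import Mathlib

/-! ### Directed graphs and factored graphs -/

/-- An explicitly given finite directed graph (loops allowed): a list of distinct vertices, named by
natural numbers, and a list of distinct ordered pairs of vertices, the directed edges. -/
structure InputGraph where
  verts : List ℕ
  edges : List (ℕ × ℕ)
  verts_nodup : verts.Nodup
  edges_nodup : edges.Nodup
  edges_mem : ∀ e ∈ edges, e.1 ∈ verts ∧ e.2 ∈ verts

/-- Factored graph formulas: expressions built from input graphs with the three binary graph
operations Cartesian product, tensor product and union. -/
inductive FactoredGraph where
  | input (G : InputGraph)
  | cart (F₁ F₂ : FactoredGraph)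
  | tensor (F₁ F₂ : FactoredGraph)
  | union (F₁ F₂ : FactoredGraph)

namespace FactoredGraph

/-- The vertex set. Vertices are flattened tuples of vertices of input graphs, so that the products
are associative and unions of products over the same vertex sets are meaningful. -/
def V : FactoredGraph → Set (List ℕ)
  | input G => {x | ∃ v ∈ G.verts, x = [v]}
  | cart F₁ F₂ => {x | ∃ a ∈ F₁.V, ∃ b ∈ F₂.V, x = a ++ b}
  | tensor F₁ F₂ => {x | ∃ a ∈ F₁.V, ∃ b ∈ F₂.V, x = a ++ b}
  | union F₁ F₂ => F₁.V ∪ F₂.V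

/-- `F.Edge x y`: there is a directed edge from `x` to `y` in the graph given by `F`. -/
def Edge : FactoredGraph → List ℕ → List ℕ → Prop
  | input G => fun x y => ∃ e ∈ G.edges, x = [e.1] ∧ y = [e.2]
  | cart F₁ F₂ => fun x y =>
      (∃ a ∈ F₁.V, ∃ b b', F₂.Edge b b' ∧ x = a ++ b ∧ y = a ++ b') ∨
      (∃ b ∈ F₂.V, ∃ a a', F₁.Edge a a' ∧ x = a ++ b ∧ y = a' ++ b)
  | tensor F₁ F₂ => fun x y =>
      ∃ a a' b b', F₁.Edge a a' ∧ F₂.Edge b b' ∧ x = a ++ b ∧ y = a' ++ b'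
  | union F₁ F₂ => fun x y => F₁.Edge x y ∨ F₂.Edge x y

/-- The number of graph operations in a formula. -/
def numOps : FactoredGraph → ℕ
  | input _ => 0
  | cart F₁ F₂ => F₁.numOps + F₂.numOps + 1
  | tensor F₁ F₂ => F₁.numOps + F₂.numOps + 1
  | union F₁ F₂ => F₁.numOps + F₂.numOps + 1

/-- The input graphs of a formula, from left to right. -/
def inputs : FactoredGraph → List InputGraph
  | input G => [G]
  | cart F₁ F₂ => F₁.inputs ++ F₂.inputs
  | tensor F₁ F₂ => F₁.inputs ++ F₂.inputs
  | union F₁ F₂ => F₁.inputs ++ F₂.inputs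

/-- Complexity `(n, k)`: the formula has `k - 1` operations, on input graphs with at most `n`
vertices each. There are then `k` input graphs, with at most `n * k` vertices altogether; up to
renaming, the vertex names are numbers below `n * k`, so that a name takes `O(log (n * k))` bits. -/
def HasComplexity (F : FactoredGraph) (n k : ℕ) : Prop :=
  F.numOps + 1 = k ∧ ∀ G ∈ F.inputs, G.verts.length ≤ n ∧ ∀ v ∈ G.verts, v < n * k

end FactoredGraph

/-- An instance of reachability on factored graphs: a factored graph with a source vertex and a
target vertex. -/
structure ReachInstance where
  graph : FactoredGraph
  source : List ℕ
  target : List ℕ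
  source_mem : source ∈ graph.V
  target_mem : target ∈ graph.V

/-- The instance is a yes-instance: a directed path leads from the source to the target. -/
def ReachInstance.Reachable (I : ReachInstance) : Prop :=
  Relation.ReflTransGen I.graph.Edge I.source I.target

/-! ### Encoding of the instances of reachability -/

/-- The alphabet in which factored graphs are written down. -/
inductive FGSymbol where
  | bit (b : Bool)
  | comma
  | close
  | input
  | cart
  | tensor
  | union
deriving DecidableEq, Fintype

/-- A number: its binary digits, least significant first, and a comma. -/
def encodeNumber (m : ℕ) : List FGSymbol :=
  m.bits.map FGSymbol.bit ++ [FGSymbol.comma]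

/-- A list of numbers, one after the other, and a closing symbol. -/
def encodeNumbers (l : List ℕ) : List FGSymbol :=
  l.flatMap encodeNumber ++ [FGSymbol.close]

/-- A graph: the list of its vertices and the list of its edges. -/
def InputGraph.encode (G : InputGraph) : List FGSymbol :=
  encodeNumbers G.verts ++ encodeNumbers (G.edges.flatMap fun e => [e.1, e.2])

/-- A formula, in prefix notation. -/
def FactoredGraph.encode : FactoredGraph → List FGSymbol
  | input G => FGSymbol.input :: G.encode
  | cart F₁ F₂ => FGSymbol.cart :: (F₁.encode ++ F₂.encode)
  | tensor F₁ F₂ => FGSymbol.tensor :: (F₁.encode ++ F₂.encode)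
  | union F₁ F₂ => FGSymbol.union :: (F₁.encode ++ F₂.encode)

/-- The word that encodes an instance of reachability. -/
def ReachInstance.encode (I : ReachInstance) : List FGSymbol :=
  I.graph.encode ++ encodeNumbers I.source ++ encodeNumbers I.target

/-! ### The orthogonal vectors problem with `k` sets -/

/-- An instance of `k`-Orthogonal-Vectors: `k` families of `n` Boolean vectors of dimension `d`. -/
structure OVInstance (k : ℕ) where
  n : ℕ
  d : ℕ
  n_pos : 0 < n
  d_pos : 0 < d
  vec : Fin k → Fin n → Fin d → Bool

/-- The instance is a yes-instance: one can choose a vector from every family such that in every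
coordinate at least one of the chosen vectors is zero. -/
def OVInstance.HasOrthogonalTuple {k : ℕ} (I : OVInstance k) : Prop :=
  ∃ j : Fin k → Fin I.n, ∀ l : Fin I.d, ∏ i : Fin k, (I.vec i (j i) l).toNat = 0

/-- The alphabet in which instances of `k`-Orthogonal-Vectors are written down. -/
inductive OVSymbol where
  | bit (b : Bool)
  | endVector
  | endSet
deriving DecidableEq, Fintype

/-- The word that encodes an instance: the coordinates of all vectors, with a marker after every
vector and a marker after every family. -/
def OVInstance.encode {k : ℕ} (I : OVInstance k) : List OVSymbol :=
  (List.finRange k).flatMap fun i =>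
    ((List.finRange I.n).flatMap fun j =>
      ((List.finRange I.d).map fun l => OVSymbol.bit (I.vec i j l)) ++ [OVSymbol.endVector]) ++
    [OVSymbol.endSet]

/-! ### Algorithms and running times -/

/-- The multi-tape Turing machine `M`, started on the word `w`, halts after at most `T` steps with
the one-symbol output that tells whether `P` holds. -/
def AnswersInTime {Γ : Type} (M : Turing.TM2ComputableAux Γ Bool) (w : List Γ) (P : Prop) (T : ℝ) :
    Prop :=
  ∃ b : Bool, (b = true ↔ P) ∧ ∃ t : ℕ, (t : ℝ) ≤ T ∧
    Nonempty (Turing.TM2OutputsInTime M.tm (w.map M.inputAlphabet.invFun)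
      (some [M.outputAlphabet.invFun b]) t)

/-- `k`-Orthogonal-Vectors can be solved in time `O(n ^ (k - ε) * poly(d))`. -/
def OVSolvableWithSaving (k : ℕ) (ε : ℝ) : Prop :=
  ∃ (M : Turing.TM2ComputableAux OVSymbol Bool) (A : ℝ) (c : ℕ), ∀ I : OVInstance k,
    AnswersInTime M I.encode I.HasOrthogonalTuple
      (A * (I.n : ℝ) ^ ((k : ℝ) - ε) * (I.d : ℝ) ^ c)

/-- The `k`-Orthogonal-Vectors conjecture: for no fixed number `k ≥ 2` of sets and no `ε > 0` does
an algorithm solve the problem in time `O(n ^ (k - ε) * poly(d))`. -/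
def OVConjecture : Prop :=
  ∀ k : ℕ, 2 ≤ k → ∀ ε : ℝ, 0 < ε → ¬ OVSolvableWithSaving k ε

/-- Reachability on factored graphs is fixed parameter tractable: one algorithm solves it on all
factored graphs of complexity `(n, k)` in time `g k * n ^ C`, with `C` independent of `k`. -/
def ReachabilityFPT : Prop :=
  ∃ (M : Turing.TM2ComputableAux FGSymbol Bool) (g : ℕ → ℕ) (C : ℕ),
    ∀ (I : ReachInstance) (n k : ℕ), I.graph.HasComplexity n k →
      AnswersInTime M I.encode I.Reachable ((g k : ℝ) * (n : ℝ) ^ C)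

/-- For this fixed `k`, some algorithm solves reachability on the factored graphs of complexity
`(n, k)` in time `O(n ^ r)`. -/
def ReachabilitySolvableWithExponent (k : ℕ) (r : ℝ) : Prop :=
  ∃ (M : Turing.TM2ComputableAux FGSymbol Bool) (A : ℝ),
    ∀ (I : ReachInstance) (n : ℕ), I.graph.HasComplexity n k →
      AnswersInTime M I.encode I.Reachable (A * (n : ℝ) ^ r)

/-! Orthogonality of a tuple of vectors can be checked by scanning all chosen vectors in lockstep,
and a tensor product of graphs moves in lockstep. Write an instance with `K` families as a word `w`.
For families `i` and `j`, the graph `scanGraph w i j` has one vertex for each position of the word,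
a source `0` and a target `1`. From `0` a walk enters the first coordinate of any vector of family
`j`, then advances one position per step, and from the end marker of the vector it goes to `1`. If
`i = j`, only coordinates equal to zero can be passed.

For fixed `i`, the tensor product over `j` chooses one vector from each family and advances all of
them together, passing a coordinate only if the vector of family `i` vanishes there. In the union
over `i`, each step may choose a different `i`. Since the family `j` occupies the same vertices in
all terms, the choice of vectors is retained throughout a walk. Hence `(0,…,0)` reaches `(1,…,1)`
exactly if some choice of vectors has a zero in every coordinate (`reachable_reductionInstance`).

The formula has `K * (K + 1) + 1` inputs, which unions with empty graphs raise to any larger number,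
and the inputs have `O(K n d)` vertices. An algorithm for reachability with exponent at most `K - 1`
therefore saves a full factor `n` for orthogonal vectors. Both claims follow by choosing `K`: a
constant in the first, about the square root of `k` in the second.

The reduction has to be carried out by a machine. Small structured programs are compiled into stack
machines with exact bookkeeping of time (`Run.stepsIn_code`) and chained with the given machine
(`answersInTime_composeTM`). The encoding of the graph is a fixed sequence of literal words and
outputs of finite transducers with a binary counter that holds the current position
(`out_reductionSegments`). Writing it takes quadratic time, which is absorbed by the exponent `K -
1` once `K ≥ 3`. -/

/-! ### Structured programs on stacks, compiled into stack machines -/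

section StepsIn

variable {α β : Type} {f : α → Option α} {a b c : α} {s t : ℕ}

/-- Iterating `f` at most `t` times leads from `a` to `b`. -/
def StepsIn (f : α → Option α) (a b : α) (t : ℕ) : Prop :=
  ∃ s ≤ t, (flip bind f)^[s] (some a) = some b

theorem StepsIn.mono (h : StepsIn f a b s) (hst : s ≤ t) : StepsIn f a b t :=
  let ⟨r, hr, h⟩ := h
  ⟨r, hr.trans hst, h⟩

theorem StepsIn.single (h : f a = some b) : StepsIn f a b 1 := ⟨1, le_rfl, h⟩

theorem StepsIn.trans (h₁ : StepsIn f a b s) (h₂ : StepsIn f b c t) : StepsIn f a c (s + t) := by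
  obtain ⟨r₁, hr₁, h₁⟩ := h₁
  obtain ⟨r₂, hr₂, h₂⟩ := h₂
  refine ⟨r₂ + r₁, by omega, ?_⟩
  rw [Function.iterate_add_apply, h₁, h₂]

theorem StepsIn.map {g : β → Option β} (φ : α → β)
    (hφ : ∀ x y, f x = some y → g (φ x) = some (φ y)) (h : StepsIn f a b t) :
    StepsIn g (φ a) (φ b) t := by
  obtain ⟨r, hr, h⟩ := h
  refine ⟨r, hr, ?_⟩
  clear hr
  induction r generalizing a with
  | zero => simpa using congrArg (Option.map φ) h
  | succ r ih =>
    rw [Function.iterate_succ_apply] at h ⊢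
    -- A halted run stays halted, so a run that ends in `some b` never passes through `none`.
    have key : ∀ m : ℕ, (flip bind f)^[m] none = none := fun m => by
      induction m with
      | zero => rfl
      | succ m ih => rw [Function.iterate_succ_apply]; exact ih
    have hfa : flip bind f (some a) = f a := rfl
    rw [hfa] at h
    cases hx : f a with
    | none => rw [hx, key] at h; cases h
    | some y =>
      have : flip bind g (some (φ a)) = some (φ y) := hφ _ _ hx
      rw [this]
      exact ih (hx ▸ h)

end StepsIn

/-- Structured programs on a family of stacks, with a register of type `σ`. -/
inductive Prog {K : Type} (Γ : K → Type) (σ : Type) where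
  | push (k : K) (f : σ → Γ k)
  | pop (k : K) (f : σ → Option (Γ k) → σ)
  | load (f : σ → σ)
  | seq (p q : Prog Γ σ)
  | dispatch (f : σ → Prog Γ σ)
  | loop (f : σ → Bool) (p : Prog Γ σ)

namespace Prog

open Turing

variable {K : Type} {Γ : K → Type} {σ : Type}

/-- `Run p c c' t`: started in `c`, the program ends in `c'` after at most `t` steps. -/
inductive Run [DecidableEq K] :
    Prog Γ σ → σ × (∀ k, List (Γ k)) → σ × (∀ k, List (Γ k)) → ℕ → Prop
  | push (k : K) (f : σ → Γ k) (v S) :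
      Run (.push k f) (v, S) (v, Function.update S k (f v :: S k)) 1
  | pop (k : K) (f : σ → Option (Γ k) → σ) (v S) :
      Run (.pop k f) (v, S) (f v (S k).head?, Function.update S k (S k).tail) 1
  | load (f : σ → σ) (v S) : Run (.load f) (v, S) (f v, S) 1
  | seq {p q : Prog Γ σ} {c c' c'' s t} : Run p c c' s → Run q c' c'' t →
      Run (.seq p q) c c'' (s + t)
  | dispatch {f : σ → Prog Γ σ} {v S c t} : Run (f v) (v, S) c t →
      Run (.dispatch f) (v, S) c (t + 1)
  | loop_false {f : σ → Bool} {p : Prog Γ σ} {v S} : f v = false →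
      Run (.loop f p) (v, S) (v, S) 1
  | loop_true {f : σ → Bool} {p : Prog Γ σ} {v S c c' s t} : f v = true → Run p (v, S) c s →
      Run (.loop f p) c c' t → Run (.loop f p) (v, S) c' (s + t + 1)
  | mono {p : Prog Γ σ} {c c' s t} : Run p c c' s → s ≤ t → Run p c c' t

/-- A step pushes at most one symbol. This bounds the length of the output by the running time, and
thereby the cost of moving it to another stack. -/
theorem Run.length_le [DecidableEq K] {p : Prog Γ σ} {c c' : σ × (∀ k, List (Γ k))} {t : ℕ}
    (h : Run p c c' t) (k : K) : (c'.2 k).length ≤ (c.2 k).length + t := by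
  induction h with
  | push k' f v S =>
    rcases eq_or_ne k k' with rfl | hk
    · simp
    · simp [Function.update_of_ne hk]
  | pop k' f v S =>
    rcases eq_or_ne k k' with rfl | hk
    · simp; omega
    · simp [Function.update_of_ne hk]
  | load | loop_false => simp
  | seq | dispatch | loop_true | mono => omega

/-- The labels of the compiled program. -/
def Label : Prog Γ σ → Type
  | push _ _ | pop _ _ | load _ => Unit
  | seq p q => p.Label ⊕ q.Label
  | dispatch f => Option (Σ v, (f v).Label)
  | loop _ p => Option p.Label

/-- The label at which the compiled program starts. -/
def entry : (p : Prog Γ σ) → p.Label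
  | push _ _ | pop _ _ | load _ => ()
  | seq p _ => .inl p.entry
  | dispatch _ | loop _ _ => none

/-- A `dispatch` holds one copy of code per register value, so finiteness of the register type is
essential. -/
theorem finite_label [Finite σ] (p : Prog Γ σ) : Finite p.Label := by
  induction p with
  | push | pop | load => exact inferInstanceAs (Finite Unit)
  | seq p q ihp ihq => exact inferInstanceAs (Finite (_ ⊕ _))
  | dispatch f ih => exact inferInstanceAs (Finite (Option (Σ v, (f v).Label)))
  | loop f p ih => exact inferInstanceAs (Finite (Option _))

/-! ### Compilation of programs into `TM2` statements -/

variable {K' : Type} {Γ' : K' → Type} {Λ τ : Type}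

/-- The stack alphabets of two machines together. -/
abbrev JoinAlphabets (Γ : K → Type) (Γ' : K' → Type) : K ⊕ K' → Type
  | .inl k => Γ k
  | .inr k => Γ' k

/-- The stacks of two machines together. -/
def joinStacks (S : ∀ k, List (Γ k)) (S' : ∀ k, List (Γ' k)) : ∀ k, List (JoinAlphabets Γ Γ' k)
  | .inl k => S k
  | .inr k => S' k

/-- The code of the program inside a machine with further stacks, labels and registers. -/
def code : (p : Prog Γ σ) → (p.Label → Λ) → TM2.Stmt (JoinAlphabets Γ Γ') Λ (σ × τ) →
    p.Label → TM2.Stmt (JoinAlphabets Γ Γ') Λ (σ × τ)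
  | push k f, _, e, _ => .push (.inl k) (fun v => f v.1) e
  | pop k f, _, e, _ => .pop (.inl k) (fun v a => (f v.1 a, v.2)) e
  | load f, _, e, _ => .load (fun v => (f v.1, v.2)) e
  | seq p q, i, _, .inl l => p.code (i ∘ .inl) (.goto fun _ => i (.inr q.entry)) l
  | seq _ q, i, e, .inr l => q.code (i ∘ .inr) e l
  | dispatch f, i, _, none => .goto fun v => i (some ⟨v.1, (f v.1).entry⟩)
  | dispatch f, i, e, some l => (f l.1).code (fun l' => i (some ⟨l.1, l'⟩)) e l.2
  | loop f p, i, e, none => .branch (fun v => f v.1) (.goto fun _ => i (some p.entry)) e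
  | loop _ p, i, _, some l => p.code (i ∘ some) (.goto fun _ => i none) l

section

variable [DecidableEq K] [DecidableEq K']

theorem update_joinStacks_inl (S : ∀ k, List (Γ k)) (S' : ∀ k, List (Γ' k)) (k : K)
    (l : List (Γ k)) :
    Function.update (joinStacks S S') (.inl k) l = joinStacks (Function.update S k l) S' := by
  funext x
  rcases x with x | x
  · rcases eq_or_ne x k with rfl | hx
    · exact (Function.update_self (Sum.inl x) _ (joinStacks S S')).trans
        (Function.update_self x l S).symm
    · exact (Function.update_of_ne (fun h => hx (Sum.inl.inj h)) _ (joinStacks S S')).trans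
        (show S x = Function.update S k l x from (Function.update_of_ne hx l S).symm)
  · exact Function.update_of_ne (fun h => by cases h) _ (joinStacks S S')

theorem update_joinStacks_inr (S : ∀ k, List (Γ k)) (S' : ∀ k, List (Γ' k)) (k : K')
    (l : List (Γ' k)) :
    Function.update (joinStacks S S') (.inr k) l = joinStacks S (Function.update S' k l) := by
  funext x
  rcases x with x | x
  · exact Function.update_of_ne (fun h => by cases h) _ (joinStacks S S')
  · rcases eq_or_ne x k with rfl | hx
    · exact (Function.update_self (Sum.inr x) _ (joinStacks S S')).trans
        (Function.update_self x l S').symm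
    · exact (Function.update_of_ne (fun h => hx (Sum.inr.inj h)) _ (joinStacks S S')).trans
        (show S' x = Function.update S' k l x from (Function.update_of_ne hx l S').symm)

/-- The statement `e` is a continuation, fused with the last instruction of the program: a single
machine step executes a whole statement, so a run ends in the result of `e`. In a sequence the
continuation of the first part jumps to the second; in a loop that of the body jumps back to the
test. Further stacks and registers are untouched. -/
theorem Run.stepsIn_code {p : Prog Γ σ} {c c' : σ × (∀ k, List (Γ k))} {t : ℕ}
    (h : Run p c c' t) (m : Λ → TM2.Stmt (JoinAlphabets Γ Γ') Λ (σ × τ)) (i : p.Label → Λ)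
    (e : TM2.Stmt (JoinAlphabets Γ Γ') Λ (σ × τ)) (hm : ∀ l, m (i l) = p.code i e l)
    (u : τ) (S' : ∀ k, List (Γ' k)) :
    StepsIn (TM2.step m) ⟨some (i p.entry), (c.1, u), joinStacks c.2 S'⟩
      (TM2.stepAux e (c'.1, u) (joinStacks c'.2 S')) t := by
  induction h generalizing e with
  | push k f v S =>
    refine .single ?_
    rw [TM2.step, hm]
    exact congrArg (fun T => some (TM2.stepAux e (v, u) T)) (update_joinStacks_inl S S' k _)
  | pop k f v S =>
    refine .single ?_
    rw [TM2.step, hm]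
    exact congrArg (fun T => some (TM2.stepAux e (f v (S k).head?, u) T))
      (update_joinStacks_inl S S' k _)
  | load f v S =>
    refine .single ?_
    rw [TM2.step, hm]
    rfl
  | seq _ _ ih₁ ih₂ =>
    exact (ih₁ (i ∘ .inl) _ (fun l => hm (.inl l))).trans (ih₂ (i ∘ .inr) e (fun l => hm (.inr l)))
  | @dispatch f v S c t _ ih =>
    rw [add_comm]
    refine .trans (.single ?_) (ih (fun l' => i (some ⟨v, l'⟩)) e (fun l => hm (some ⟨v, l⟩)))
    rw [TM2.step, hm]
    rfl
  | @loop_false f p v S hf =>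
    refine .single ?_
    rw [TM2.step, hm]
    show some (cond (f v) _ _) = _
    rw [hf]
    rfl
  | @loop_true f p v S c c' s t hf _ _ ih₁ ih₂ =>
    rw [add_comm]
    refine .trans (.single ?_) ((ih₁ (i ∘ some) _ (fun l => hm (some l))).trans (ih₂ i e hm))
    rw [TM2.step, hm]
    show some (cond (f v) _ _) = _
    rw [hf]
    rfl
  | mono _ hst ih => exact (ih i e hm).mono hst

end

end Prog

/-! ### A program followed by a machine -/

namespace Prog

open Turing

section Lift

variable {K K' : Type} {Γ : K → Type} {Γ' : K' → Type} {Λ Λ' σ τ σ' : Type}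

/-- A statement of a machine as a statement of a machine with further stacks and registers. -/
def liftStmt (i : Λ' → Λ) : TM2.Stmt Γ' Λ' σ' → TM2.Stmt (JoinAlphabets Γ Γ') Λ (σ × τ × σ')
  | .push k f q => .push (.inr k) (fun v => f v.2.2) (liftStmt i q)
  | .peek k f q => .peek (.inr k) (fun v a => (v.1, v.2.1, f v.2.2 a)) (liftStmt i q)
  | .pop k f q => .pop (.inr k) (fun v a => (v.1, v.2.1, f v.2.2 a)) (liftStmt i q)
  | .load f q => .load (fun v => (v.1, v.2.1, f v.2.2)) (liftStmt i q)
  | .branch f q q' => .branch (fun v => f v.2.2) (liftStmt i q) (liftStmt i q')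
  | .goto f => .goto fun v => i (f v.2.2)
  | .halt => .halt

/-- A configuration of a machine as a configuration of a machine with further stacks and
registers. -/
def liftCfg (i : Λ' → Λ) (v : σ) (r : τ) (S : ∀ k, List (Γ k)) (c : TM2.Cfg Γ' Λ' σ') :
    TM2.Cfg (JoinAlphabets Γ Γ') Λ (σ × τ × σ') :=
  ⟨c.l.map i, (v, r, c.var), joinStacks S c.stk⟩

variable [DecidableEq K] [DecidableEq K']

theorem stepAux_liftStmt (i : Λ' → Λ) (v : σ) (r : τ) (S : ∀ k, List (Γ k)) (q : TM2.Stmt Γ' Λ' σ')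
    (v' : σ') (S' : ∀ k, List (Γ' k)) :
    TM2.stepAux (liftStmt i q) (v, r, v') (joinStacks S S') =
      liftCfg i v r S (TM2.stepAux q v' S') := by
  induction q generalizing v' S' with
  | push k f q ih =>
    rw [TM2.stepAux, ← ih, ← update_joinStacks_inr]
    rfl
  | peek k f q ih =>
    rw [TM2.stepAux, ← ih]
    rfl
  | pop k f q ih =>
    rw [TM2.stepAux, ← ih, ← update_joinStacks_inr]
    rfl
  | load f q ih =>
    rw [TM2.stepAux, ← ih]
    rfl
  | branch f q q' ih ih' =>
    rw [TM2.stepAux]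
    show cond (f v') _ _ = _
    cases f v'
    · exact ih' _ _
    · exact ih _ _
  | goto f => rfl
  | halt => rfl

theorem step_liftCfg (i : Λ' → Λ) (v : σ) (r : τ) (S : ∀ k, List (Γ k)) {m' : Λ' → TM2.Stmt Γ' Λ' σ'}
    {m : Λ → TM2.Stmt (JoinAlphabets Γ Γ') Λ (σ × τ × σ')} (hm : ∀ l, m (i l) = liftStmt i (m' l))
    (c c' : TM2.Cfg Γ' Λ' σ') (h : TM2.step m' c = some c') :
    TM2.step m (liftCfg i v r S c) = some (liftCfg i v r S c') := by
  obtain ⟨_ | l, w, T⟩ := c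
  · cases h
  · obtain rfl := Option.some.inj h
    exact congrArg some ((congrArg (fun s => TM2.stepAux s (v, r, w) (joinStacks S T)) (hm l)).trans
      (stepAux_liftStmt i v r S _ w T))

end Lift

section Compose

variable {K : Type} [DecidableEq K] {Γ : K → Type} {σ : Type}

/-- The code of the machine that runs a program, moves the contents of the stack `kout` to the
input stack of another machine, and runs that machine. -/
def composeCode (p : Prog Γ σ) (kout : K) [Inhabited (Γ kout)] {δ : Type}
    (M : TM2ComputableAux (Γ kout) δ) :
    p.Label ⊕ Option M.tm.Λ → TM2.Stmt (JoinAlphabets Γ M.tm.Γ) (p.Label ⊕ Option M.tm.Λ)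
      (σ × Option (Γ kout) × M.tm.σ)
  | .inl l => p.code .inl (.goto fun _ => .inr none) l
  | .inr none =>
      .pop (.inl kout) (fun v a => (v.1, a, v.2.2)) <|
        .branch (fun v => v.2.1.isSome)
          (.push (.inr M.tm.k₀) (fun v => M.inputAlphabet.symm (v.2.1.getD default)) <|
            .goto fun _ => .inr none)
          (.goto fun _ => .inr (some M.tm.main))
  | .inr (some l) => liftStmt (fun l => .inr (some l)) (M.tm.m l)

/-- The machine that runs a program, moves the contents of the stack `kout` to the input stack of
another machine, and runs that machine. -/
noncomputable def composeTM [Fintype K] [Fintype σ] (p : Prog Γ σ) (kin kout : K) (v₀ : σ) [Fintype (Γ kin)]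
    [Fintype (Γ kout)] [Inhabited (Γ kout)] {δ : Type} (M : TM2ComputableAux (Γ kout) δ) :
    TM2ComputableAux (Γ kin) δ where
  tm :=
    letI := @Fintype.ofFinite _ p.finite_label
    letI := M.tm.kFin
    letI := M.tm.ΛFin
    letI := M.tm.σFin
    letI : Fintype (JoinAlphabets Γ M.tm.Γ (.inl kin)) := inferInstanceAs (Fintype (Γ kin))
    { K := K ⊕ M.tm.K
      k₀ := .inl kin
      k₁ := .inr M.tm.k₁
      Γ := JoinAlphabets Γ M.tm.Γ
      Λ := p.Label ⊕ Option M.tm.Λ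
      main := .inl p.entry
      σ := σ × Option (Γ kout) × M.tm.σ
      initialState := (v₀, none, M.tm.initialState)
      m := composeCode p kout M }
  inputAlphabet := Equiv.refl _
  outputAlphabet := M.outputAlphabet

/-- Pop, test, push and jump form one statement, so each symbol costs one step, and one more detects
the empty stack. The move reverses the word; the final pop leaves `none` in the auxiliary register,
its initial value. -/
theorem stepsIn_transfer (p : Prog Γ σ) (kout : K) [Inhabited (Γ kout)] {δ : Type}
    (M : TM2ComputableAux (Γ kout) δ) (v : σ) (r : Option (Γ kout)) (s : M.tm.σ)
    (u : List (Γ kout)) (x : List (M.tm.Γ M.tm.k₀)) :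
    StepsIn (TM2.step (composeCode p kout M))
      ⟨some (.inr none), (v, r, s),
        joinStacks (Function.update (fun _ => []) kout u) (Function.update (fun _ => []) M.tm.k₀ x)⟩
      ⟨some (.inr (some M.tm.main)), (v, none, s),
        joinStacks (fun _ => []) (Function.update (fun _ => []) M.tm.k₀
          (u.reverse.map M.inputAlphabet.symm ++ x))⟩ (u.length + 1) := by
  have hA : ∀ (l : List (Γ kout)) (B : ∀ k, List (M.tm.Γ k)),
      joinStacks (Function.update (fun _ => []) kout l) B (.inl kout) = l :=
    fun l B => Function.update_self (β := fun k => List (Γ k)) kout l (fun _ => [])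
  have hB : ∀ (l : List (M.tm.Γ M.tm.k₀)) (A : ∀ k, List (Γ k)),
      joinStacks A (Function.update (fun _ => []) M.tm.k₀ l) (.inr M.tm.k₀) = l :=
    fun l B => Function.update_self (β := fun k => List (M.tm.Γ k)) M.tm.k₀ l (fun _ => [])
  induction u generalizing x r with
  | nil =>
    refine .single (congrArg some ?_)
    rw [composeCode, TM2.stepAux, hA, update_joinStacks_inl]
    simp [TM2.stepAux]
  | cons a u ih =>
    have hu : (a :: u).reverse.map M.inputAlphabet.symm ++ x =
        u.reverse.map M.inputAlphabet.symm ++ M.inputAlphabet.symm a :: x := by simp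
    rw [List.length_cons, add_comm, hu]
    refine .trans (.single (congrArg some ?_)) (ih (some a) (M.inputAlphabet.symm a :: x))
    rw [composeCode, TM2.stepAux, hA, update_joinStacks_inl]
    simp only [List.head?_cons, TM2.stepAux, Option.isSome_some, cond_true, Option.getD_some]
    rw [hB, update_joinStacks_inr]
    simp

theorem initList_eq (tm : FinTM2) (w : List (tm.Γ tm.k₀)) :
    initList tm w = ⟨some tm.main, tm.initialState, Function.update (fun _ => []) tm.k₀ w⟩ := by
  unfold initList
  congr 1
  funext k
  by_cases h : k = tm.k₀
  · subst h; simp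
  · simp [h]

theorem haltList_eq (tm : FinTM2) (w : List (tm.Γ tm.k₁)) :
    haltList tm w = ⟨none, tm.initialState, Function.update (fun _ => []) tm.k₁ w⟩ := by
  unfold haltList
  congr 1
  funext k
  by_cases h : k = tm.k₁
  · subst h; simp
  · simp [h]

/-- The three phases take `t`, `u.length + 1 ≤ t + 1` and `s` steps. A machine must halt with its
initial register and with all stacks but the output empty; this is why the program has to restore
`v₀` and leave nothing except its output. That output is reversed because the transfer reverses it
again. -/
theorem answersInTime_composeTM [Fintype K] [Fintype σ] {p : Prog Γ σ} {kin kout : K} (hk : kin ≠ kout) {v₀ : σ}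
    [Fintype (Γ kin)] [Fintype (Γ kout)] [Inhabited (Γ kout)] (M : TM2ComputableAux (Γ kout) Bool)
    {w : List (Γ kin)} {u : List (Γ kout)} {t : ℕ}
    (hp : Run p (v₀, Function.update (fun _ => []) kin w)
      (v₀, Function.update (fun _ => []) kout u.reverse) t)
    {P : Prop} {T : ℝ} (hM : AnswersInTime M u P T) :
    AnswersInTime (composeTM p kin kout v₀ M) w P (2 * t + 1 + T) := by
  obtain ⟨b, hb, s, hs, ⟨h⟩⟩ := hM
  refine ⟨b, hb, 2 * t + 1 + s, by push_cast; linarith, ?_⟩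
  have hlen : u.length ≤ t := by
    have := hp.length_le kout
    simpa [hk.symm] using this
  have h₁ := hp.stepsIn_code (composeCode p kout M) .inl (.goto fun _ => .inr none)
    (fun _ => rfl) (none, M.tm.initialState) (fun _ => [])
  have h₂ := stepsIn_transfer p kout M v₀ none M.tm.initialState u.reverse []
  have h₃ : StepsIn (TM2.step M.tm.m) _ _ s := ⟨h.steps, h.steps_le_m, h.evals_in_steps⟩
  have h₄ := h₃.map (liftCfg (Γ := Γ) (Λ := p.Label ⊕ Option M.tm.Λ) (fun l => .inr (some l)) v₀
    (none : Option (Γ kout)) (fun _ => [])) (step_liftCfg _ v₀ none _ (m := composeCode p kout M)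
      fun _ => rfl)
  rw [initList_eq, haltList_eq] at h₄
  rw [List.reverse_reverse, List.append_nil, List.length_reverse, Function.update_eq_self] at h₂
  obtain ⟨r, hr, h⟩ := (((h₁.trans h₂).trans h₄).mono
    (show t + (u.length + 1) + s ≤ 2 * t + 1 + s by omega))
  refine ⟨⟨⟨r, ?_⟩, hr⟩⟩
  rw [initList_eq, Option.map_some, haltList_eq]
  have hi := update_joinStacks_inl (Γ' := M.tm.Γ) (fun k => ([] : List (Γ k))) (fun _ => []) kin w
  have ho := update_joinStacks_inr (Γ := Γ) (fun _ => []) (fun k => ([] : List (M.tm.Γ k)))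
    M.tm.k₁ [M.outputAlphabet.symm b]
  have hn : joinStacks (fun k => ([] : List (Γ k))) (fun k => ([] : List (M.tm.Γ k))) =
      fun _ => [] := by
    funext x
    cases x <;> rfl
  rw [hn] at hi ho
  have hw : w.map (composeTM p kin kout v₀ M).inputAlphabet.invFun = w := List.map_id w
  rw [hw]
  have hstart : (⟨some (.inl p.entry), (v₀, none, M.tm.initialState),
      joinStacks (Function.update (fun _ => []) kin w) fun _ => []⟩ :
      TM2.Cfg (JoinAlphabets Γ M.tm.Γ) (p.Label ⊕ Option M.tm.Λ)
        (σ × Option (Γ kout) × M.tm.σ)) =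
      ⟨some (.inl p.entry), (v₀, none, M.tm.initialState),
        Function.update (fun _ => []) (.inl kin) w⟩ := by rw [hi]
  have hend : (⟨none, (v₀, none, M.tm.initialState),
      joinStacks (fun _ => []) (Function.update (fun _ => []) M.tm.k₁ [M.outputAlphabet.symm b])⟩ :
      TM2.Cfg (JoinAlphabets Γ M.tm.Γ) (p.Label ⊕ Option M.tm.Λ)
        (σ × Option (Γ kout) × M.tm.σ)) =
      ⟨none, (v₀, none, M.tm.initialState),
        Function.update (fun _ => []) (.inr M.tm.k₁) [M.outputAlphabet.symm b]⟩ := by rw [ho]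
  exact (congrArg (fun c => (flip bind (TM2.step (composeCode p kout M)))^[r] (some c))
    hstart.symm).trans (h.trans (congrArg some hend))

end Compose

end Prog

/-! ### Counter transducers -/

/-- The stacks of the programs that write instances of reachability: the input, the part of the
input that has been read, a binary counter, a work space for the counter, and the output. -/
inductive GenStack where
  | inp
  | back
  | cnt
  | tmp
  | out
deriving DecidableEq

instance : Fintype GenStack :=
  ⟨{.inp, .back, .cnt, .tmp, .out}, fun x => by cases x <;> simp⟩

/-- The alphabets of the stacks. -/
abbrev GenAlphabet : GenStack → Type
  | .inp | .back => OVSymbol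
  | .cnt | .tmp => Bool
  | .out => FGSymbol

/-- The stacks with given contents. -/
def genStacks (a b : List OVSymbol) (c d : List Bool) (o : List FGSymbol) :
    ∀ k, List (GenAlphabet k)
  | .inp => a
  | .back => b
  | .cnt => c
  | .tmp => d
  | .out => o

/-- The registers: a control state, the symbol read last and the bit read last. -/
abbrev GenReg (Q : Type) : Type := Q × Option OVSymbol × Option Bool

section Update

variable (a b x : List OVSymbol) (c d y : List Bool) (o z : List FGSymbol)

theorem update_inp : Function.update (genStacks a b c d o) .inp x = genStacks x b c d o := by
  funext k; cases k <;> rfl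

theorem update_back : Function.update (genStacks a b c d o) .back x = genStacks a x c d o := by
  funext k; cases k <;> rfl

theorem update_cnt : Function.update (genStacks a b c d o) .cnt y = genStacks a b y d o := by
  funext k; cases k <;> rfl

theorem update_tmp : Function.update (genStacks a b c d o) .tmp y = genStacks a b c y o := by
  funext k; cases k <;> rfl

theorem update_out : Function.update (genStacks a b c d o) .out z = genStacks a b c d z := by
  funext k; cases k <;> rfl

end Update

namespace Prog

variable {Q : Type}

/-- The bit read last. -/
def regBit (v : GenReg Q) : Bool := v.2.2.getD false

/-- The symbol read last. -/
def regSym (v : GenReg Q) : OVSymbol := v.2.1.getD .endSet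

def popInp : Prog GenAlphabet (GenReg Q) := .pop .inp fun v a => (v.1, a, v.2.2)
def popBack : Prog GenAlphabet (GenReg Q) := .pop .back fun v a => (v.1, a, v.2.2)
def popCnt : Prog GenAlphabet (GenReg Q) := .pop .cnt fun v a => (v.1, v.2.1, a)
def popTmp : Prog GenAlphabet (GenReg Q) := .pop .tmp fun v a => (v.1, v.2.1, a)
def pushInp (f : GenReg Q → OVSymbol) : Prog GenAlphabet (GenReg Q) := .push .inp f
def pushBack (f : GenReg Q → OVSymbol) : Prog GenAlphabet (GenReg Q) := .push .back f
def pushCnt (f : GenReg Q → Bool) : Prog GenAlphabet (GenReg Q) := .push .cnt f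
def pushTmp (f : GenReg Q → Bool) : Prog GenAlphabet (GenReg Q) := .push .tmp f
def pushOut (f : GenReg Q → FGSymbol) : Prog GenAlphabet (GenReg Q) := .push .out f

section Basic

variable (q : Q) (s : Option OVSymbol) (r : Option Bool) (v : GenReg Q)
  (a b : List OVSymbol) (c d : List Bool) (o : List FGSymbol)

theorem run_popInp : Run popInp ((q, s, r), genStacks a b c d o)
    ((q, a.head?, r), genStacks a.tail b c d o) 1 := by
  have := Run.pop GenStack.inp (fun (v : GenReg Q) a => (v.1, a, v.2.2)) (q, s, r)
    (genStacks a b c d o)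
  rwa [update_inp] at this

theorem run_popBack : Run popBack ((q, s, r), genStacks a b c d o)
    ((q, b.head?, r), genStacks a b.tail c d o) 1 := by
  have := Run.pop GenStack.back (fun (v : GenReg Q) a => (v.1, a, v.2.2)) (q, s, r)
    (genStacks a b c d o)
  rwa [update_back] at this

theorem run_popCnt : Run popCnt ((q, s, r), genStacks a b c d o)
    ((q, s, c.head?), genStacks a b c.tail d o) 1 := by
  have := Run.pop GenStack.cnt (fun (v : GenReg Q) a => (v.1, v.2.1, a)) (q, s, r)
    (genStacks a b c d o)
  rwa [update_cnt] at this

theorem run_popTmp : Run popTmp ((q, s, r), genStacks a b c d o)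
    ((q, s, d.head?), genStacks a b c d.tail o) 1 := by
  have := Run.pop GenStack.tmp (fun (v : GenReg Q) a => (v.1, v.2.1, a)) (q, s, r)
    (genStacks a b c d o)
  rwa [update_tmp] at this

theorem run_pushInp (f : GenReg Q → OVSymbol) : Run (pushInp f) (v, genStacks a b c d o)
    (v, genStacks (f v :: a) b c d o) 1 := by
  have := Run.push GenStack.inp f v (genStacks a b c d o)
  rwa [update_inp] at this

theorem run_pushBack (f : GenReg Q → OVSymbol) : Run (pushBack f) (v, genStacks a b c d o)
    (v, genStacks a (f v :: b) c d o) 1 := by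
  have := Run.push GenStack.back f v (genStacks a b c d o)
  rwa [update_back] at this

theorem run_pushCnt (f : GenReg Q → Bool) : Run (pushCnt f) (v, genStacks a b c d o)
    (v, genStacks a b (f v :: c) d o) 1 := by
  have := Run.push GenStack.cnt f v (genStacks a b c d o)
  rwa [update_cnt] at this

theorem run_pushTmp (f : GenReg Q → Bool) : Run (pushTmp f) (v, genStacks a b c d o)
    (v, genStacks a b c (f v :: d) o) 1 := by
  have := Run.push GenStack.tmp f v (genStacks a b c d o)
  rwa [update_tmp] at this

theorem run_pushOut (f : GenReg Q → FGSymbol) : Run (pushOut f) (v, genStacks a b c d o)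
    (v, genStacks a b c d (f v :: o)) 1 := by
  have := Run.push GenStack.out f v (genStacks a b c d o)
  rwa [update_out] at this

end Basic

/-- Moves the contents of the work space back to the counter. -/
def restore : Prog GenAlphabet (GenReg Q) :=
  .seq popTmp (.loop (fun v => v.2.2.isSome) (.seq (pushCnt regBit) popTmp))

/-- Writes the counter and a comma to the output. -/
def writeNum : Prog GenAlphabet (GenReg Q) :=
  .seq popCnt <| .seq
    (.loop (fun v => v.2.2.isSome)
      (.seq (pushTmp regBit) (.seq (pushOut fun v => .bit (regBit v)) popCnt)))
    (.seq (pushOut fun _ => .comma) restore)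

/-- Increments the counter. -/
def increment : Prog GenAlphabet (GenReg Q) :=
  .seq popCnt <| .seq
    (.loop (fun v => v.2.2 == some true) (.seq (pushTmp fun _ => false) popCnt))
    (.seq (pushCnt fun _ => true) restore)

/-- Empties the counter. -/
def clearCnt : Prog GenAlphabet (GenReg Q) :=
  .seq popCnt (.loop (fun v => v.2.2.isSome) popCnt)

/-- Empties the input. -/
def clearInp : Prog GenAlphabet (GenReg Q) :=
  .seq popInp (.loop (fun v => v.2.1.isSome) popInp)

/-- Moves the part of the input that has been read back to the input. -/
def rewind : Prog GenAlphabet (GenReg Q) :=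
  .seq popBack (.loop (fun v => v.2.1.isSome) (.seq (pushInp regSym) popBack))

/-- The successor in binary. -/
def incBits : List Bool → List Bool
  | [] => [true]
  | false :: c => true :: c
  | true :: c => false :: incBits c

theorem incBits_bits (m : ℕ) : incBits m.bits = (m + 1).bits := by
  induction m using Nat.binaryRec' with
  | zero => simp [incBits]
  | bit b m h ih =>
    rw [Nat.bits_append_bit m b h]
    cases b with
    | false =>
      rw [incBits]
      have : Nat.bit false m + 1 = Nat.bit true m := by simp [Nat.bit]
      rw [this, Nat.bits_append_bit m true (by simp)]
    | true =>
      rw [incBits, ih]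
      have : Nat.bit true m + 1 = Nat.bit false (m + 1) := by simp [Nat.bit]; omega
      rw [this, Nat.bits_append_bit (m + 1) false (by simp)]

/-- A linear bound in place of the logarithm suffices, since quadratic writing time is affordable.
-/
theorem length_bits_le (m : ℕ) : m.bits.length ≤ m := by
  rw [Nat.size_eq_bits_len, Nat.size_le]
  exact Nat.lt_two_pow_self

/-! ### Running times of the programs for the counter and the input -/

section Number

variable (q : Q) (s : Option OVSymbol) (r : Option Bool)
  (a b : List OVSymbol) (c d : List Bool) (o : List FGSymbol)

theorem run_restore : Run restore ((q, s, r), genStacks a b c d o)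
    ((q, s, none), genStacks a b (d.reverse ++ c) [] o) (3 * d.length + 2) := by
  -- Loops read one symbol ahead: at each test the register holds the head of the list that remains,
  -- and the stack holds its tail. The later loops have the same form.
  suffices h : Run (.loop (fun v => v.2.2.isSome) (.seq (pushCnt regBit) popTmp))
      ((q, s, d.head?), genStacks a b c d.tail o)
      ((q, s, none), genStacks a b (d.reverse ++ c) [] o) (3 * d.length + 1) from
    ((run_popTmp q s r a b c d o).seq h).mono (by omega)
  induction d generalizing c with
  | nil => exact .loop_false rfl
  | cons x d ih =>
    have h := (run_pushCnt (q, s, some x) a b c d o regBit).seq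
      (run_popTmp q s (some x) a b (x :: c) d o)
    simpa using ((Run.loop_true rfl h (ih (x :: c))).mono
      (show 1 + 1 + (3 * d.length + 1) + 1 ≤ 3 * (d.length + 1) + 1 by omega))

theorem run_writeNum : Run writeNum ((q, s, r), genStacks a b c [] o)
    ((q, s, none), genStacks a b c [] ((c.map FGSymbol.bit ++ [FGSymbol.comma]).reverse ++ o))
    (7 * c.length + 5) := by
  have h : ∀ (c d : List Bool) (o : List FGSymbol), Run (.loop (fun v => v.2.2.isSome)
      (.seq (pushTmp regBit) (.seq (pushOut fun v => .bit (regBit v)) popCnt)))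
      ((q, s, c.head?), genStacks a b c.tail d o)
      ((q, s, none), genStacks a b [] (c.reverse ++ d) ((c.map FGSymbol.bit).reverse ++ o))
      (4 * c.length + 1) := by
    intro c
    induction c with
    | nil => exact fun _ _ => .loop_false rfl
    | cons x c ih =>
      intro d o
      have h := (run_pushTmp (q, s, some x) a b c d o regBit).seq
        ((run_pushOut (q, s, some x) a b c (x :: d) o fun v => .bit (regBit v)).seq
          (run_popCnt q s (some x) a b c (x :: d) (.bit x :: o)))
      simpa using ((Run.loop_true rfl h (ih (x :: d) (.bit x :: o))).mono
        (show 1 + (1 + 1) + (4 * c.length + 1) + 1 ≤ 4 * (c.length + 1) + 1 by omega))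
  have h' := ((run_popCnt q s r a b c [] o).seq ((h c [] o).seq
    ((run_pushOut (q, s, none) a b [] (c.reverse ++ []) _ fun _ => .comma).seq
      (run_restore q s none a b [] _ _))))
  simpa [writeNum] using h'.mono
    (show _ ≤ 7 * c.length + 5 by simp only [List.append_nil, List.length_reverse]; omega)

theorem run_increment : Run increment ((q, s, r), genStacks a b c [] o)
    ((q, s, none), genStacks a b (incBits c) [] o) (6 * c.length + 5) := by
  -- The loop turns leading ones into zeros on the work space. It stops at a zero, which it has
  -- popped and drops, or at the end; in both cases the digit `true` takes that place, which gives
  -- the first equation.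
  have h : ∀ c d : List Bool, ∃ (r' : Option Bool) (c' d' : List Bool),
      d'.reverse ++ true :: c' = d.reverse ++ incBits c ∧ d'.length ≤ d.length + c.length ∧
      Run (.loop (fun v => v.2.2 == some true) (.seq (pushTmp fun _ => false) popCnt))
        ((q, s, c.head?), genStacks a b c.tail d o)
        ((q, s, r'), genStacks a b c' d' o) (3 * c.length + 1) := by
    intro c
    induction c with
    | nil => exact fun d => ⟨_, _, _, rfl, by simp, .loop_false rfl⟩
    | cons x c ih =>
      intro d
      cases x with
      | false => exact ⟨_, _, _, rfl, by simp, (Run.loop_false rfl).mono (by simp)⟩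
      | true =>
        obtain ⟨r', c', d', h₁, h₂, h₃⟩ := ih (false :: d)
        refine ⟨r', c', d', by simpa [incBits] using h₁, by simp at h₂ ⊢; omega, ?_⟩
        have h := (run_pushTmp (q, s, some true) a b c d o fun _ => false).seq
          (run_popCnt q s (some true) a b c (false :: d) o)
        exact (Run.loop_true rfl h h₃).mono (by simp; omega)
  obtain ⟨r', c', d', h₁, h₂, h₃⟩ := h c []
  have h' := (run_popCnt q s r a b c [] o).seq (h₃.seq
    ((run_pushCnt (q, s, r') a b c' d' o fun _ => true).seq (run_restore q s r' a b _ d' o)))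
  rw [h₁] at h'
  exact h'.mono (by simp at h₂; omega)

theorem run_clearCnt : Run clearCnt ((q, s, r), genStacks a b c d o)
    ((q, s, none), genStacks a b [] d o) (2 * c.length + 2) := by
  suffices h : Run (.loop (fun v => v.2.2.isSome) popCnt)
      ((q, s, c.head?), genStacks a b c.tail d o)
      ((q, s, none), genStacks a b [] d o) (2 * c.length + 1) from
    ((run_popCnt q s r a b c d o).seq h).mono (by omega)
  induction c with
  | nil => exact .loop_false rfl
  | cons x c ih =>
    exact (Run.loop_true rfl (run_popCnt q s (some x) a b c d o) ih).mono (by simp; omega)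

theorem run_clearInp : Run clearInp ((q, s, r), genStacks a b c d o)
    ((q, none, r), genStacks [] b c d o) (2 * a.length + 2) := by
  suffices h : Run (.loop (fun v => v.2.1.isSome) popInp)
      ((q, a.head?, r), genStacks a.tail b c d o)
      ((q, none, r), genStacks [] b c d o) (2 * a.length + 1) from
    ((run_popInp q s r a b c d o).seq h).mono (by omega)
  induction a with
  | nil => exact .loop_false rfl
  | cons x a ih =>
    exact (Run.loop_true rfl (run_popInp q (some x) r a b c d o) ih).mono (by simp; omega)

theorem run_rewind : Run rewind ((q, s, r), genStacks a b c d o)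
    ((q, none, r), genStacks (b.reverse ++ a) [] c d o) (3 * b.length + 2) := by
  suffices h : Run (.loop (fun v => v.2.1.isSome) (.seq (pushInp regSym) popBack))
      ((q, b.head?, r), genStacks a b.tail c d o)
      ((q, none, r), genStacks (b.reverse ++ a) [] c d o) (3 * b.length + 1) from
    ((run_popBack q s r a b c d o).seq h).mono (by omega)
  induction b generalizing a with
  | nil => exact .loop_false rfl
  | cons x b ih =>
    have h := (run_pushInp (q, some x, r) a b c d o regSym).seq
      (run_popBack q (some x) r (x :: a) b c d o)
    simpa using ((Run.loop_true rfl h (ih (x :: a))).mono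
      (show 1 + 1 + (3 * b.length + 1) + 1 ≤ 3 * (b.length + 1) + 1 by omega))

end Number

end Prog

/-- What a transducer with a counter does when it reads a symbol: it writes a symbol, writes the
counter, or increments the counter. -/
inductive CounterAction where
  | lit (a : FGSymbol)
  | num
  | inc

namespace CounterAction

/-- The counter after a list of actions. -/
def next : ℕ → List CounterAction → ℕ
  | m, [] => m
  | m, .lit _ :: l => next m l
  | m, .num :: l => next m l
  | m, .inc :: l => next (m + 1) l

/-- The word written by a list of actions. -/
def out : ℕ → List CounterAction → List FGSymbol
  | _, [] => []
  | m, .lit a :: l => a :: out m l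
  | m, .num :: l => encodeNumber m ++ out m l
  | m, .inc :: l => out (m + 1) l

theorem le_next (m : ℕ) (l : List CounterAction) : m ≤ next m l := by
  fun_induction next m l <;> omega

theorem next_le (m : ℕ) (l : List CounterAction) : next m l ≤ m + l.length := by
  fun_induction next m l <;> simp only [List.length_cons, List.length_nil] <;> omega

theorem out_map_lit (m : ℕ) (l : List FGSymbol) : out m (l.map lit) = l := by
  induction l with
  | nil => rfl
  | cons a l ih => rw [List.map_cons, out, ih]

theorem next_map_lit (m : ℕ) (l : List FGSymbol) : next m (l.map lit) = m := by
  induction l with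
  | nil => rfl
  | cons a l ih => rw [List.map_cons, next, ih]

end CounterAction

/-- A transducer with a counter. The counter starts at `2`. -/
structure CounterTransducer (Q : Type) where
  start : Q
  emit : Q → OVSymbol → List CounterAction
  next : Q → OVSymbol → Q
  length_emit : ∀ q a, (emit q a).length ≤ 5

namespace CounterTransducer

variable {Q : Type} (τ : CounterTransducer Q)

/-- The word written from a state, with a value of the counter. -/
def out : Q → ℕ → List OVSymbol → List FGSymbol
  | _, _, [] => []
  | q, m, a :: w =>
      CounterAction.out m (τ.emit q a) ++
        out (τ.next q a) (CounterAction.next m (τ.emit q a)) w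

/-- The counter at the end. -/
def count : Q → ℕ → List OVSymbol → ℕ
  | _, m, [] => m
  | q, m, a :: w => count (τ.next q a) (CounterAction.next m (τ.emit q a)) w

theorem le_count (q : Q) (m : ℕ) (w : List OVSymbol) : m ≤ τ.count q m w := by
  induction w generalizing q m with
  | nil => rfl
  | cons a w ih => exact (CounterAction.le_next _ _).trans (ih _ _)

theorem count_le (q : Q) (m : ℕ) (w : List OVSymbol) : τ.count q m w ≤ m + 5 * w.length := by
  induction w generalizing q m with
  | nil => exact le_rfl
  | cons a w ih =>
    have h₁ := ih (τ.next q a) (CounterAction.next m (τ.emit q a))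
    have h₂ := CounterAction.next_le m (τ.emit q a)
    have h₃ := τ.length_emit q a
    rw [count, List.length_cons]
    omega

end CounterTransducer

/-- A part of a word that is computed from an input: a fixed word, or what a transducer writes. -/
inductive Segment (Q : Type) where
  | lit (l : List FGSymbol)
  | pass (τ : CounterTransducer Q)

/-- The word written by a segment on an input. -/
def Segment.out {Q : Type} (w : List OVSymbol) : Segment Q → List FGSymbol
  | .lit l => l
  | .pass τ => τ.out τ.start 2 w

/-! ### Programs that run transducers and write segments -/

namespace Prog

variable {Q : Type}

/-- Performs a list of actions. -/
def actions : List CounterAction → Prog GenAlphabet (GenReg Q)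
  | [] => .load id
  | .lit a :: l => .seq (pushOut fun _ => a) (actions l)
  | .num :: l => .seq writeNum (actions l)
  | .inc :: l => .seq increment (actions l)

/-- The counter never decreases, so a bound `N` on its final value bounds all intermediate values
and their numbers of digits. The cost `7 * N + 5` of writing a number dominates the other actions.
-/
theorem run_actions (q : Q) (s : Option OVSymbol) (r : Option Bool) (a b : List OVSymbol)
    (o : List FGSymbol) (m N : ℕ) (l : List CounterAction) (hN : CounterAction.next m l ≤ N) :
    ∃ r', Run (actions l) ((q, s, r), genStacks a b m.bits [] o)
      ((q, s, r'), genStacks a b (CounterAction.next m l).bits []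
        ((CounterAction.out m l).reverse ++ o)) (l.length * (7 * N + 5) + 1) := by
  have hm := (CounterAction.le_next m l).trans hN
  induction l generalizing m r o with
  | nil => exact ⟨r, (Run.load id _ _).mono (by omega)⟩
  | cons i l ih =>
    have hb := (length_bits_le m).trans hm
    cases i with
    | lit x =>
      obtain ⟨r', h⟩ := ih r (x :: o) m hN hm
      refine ⟨r', ?_⟩
      simpa [actions, CounterAction.out, CounterAction.next] using ((run_pushOut (q, s, r) a b m.bits [] o fun _ => x).seq
        h).mono (show _ ≤ (l.length + 1) * (7 * N + 5) + 1 by rw [add_mul]; omega)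
    | num =>
      obtain ⟨r', h⟩ := ih none _ m hN hm
      refine ⟨r', ?_⟩
      simpa [actions, CounterAction.out, CounterAction.next, encodeNumber] using ((run_writeNum q s r a b m.bits o).seq
        h).mono (show _ ≤ (l.length + 1) * (7 * N + 5) + 1 by rw [add_mul]; omega)
    | inc =>
      obtain ⟨r', h⟩ := ih none o (m + 1) hN ((CounterAction.le_next _ l).trans hN)
      have h' := run_increment q s r a b m.bits o
      rw [incBits_bits] at h'
      exact ⟨r', (h'.seq h).mono (by rw [List.length_cons, add_mul]; omega)⟩

/-- Reads the input by a transducer. -/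
def transduceLoop (τ : CounterTransducer Q) : Prog GenAlphabet (GenReg Q) :=
  .loop (fun v => v.2.1.isSome) <|
    .seq (pushBack regSym) <| .seq (.dispatch fun v => actions (τ.emit v.1 (regSym v))) <|
      .seq (.load fun v => (τ.next v.1 (regSym v), v.2)) popInp

theorem run_transduceLoop (τ : CounterTransducer Q) (q : Q) (r : Option Bool)
    (w b : List OVSymbol) (o : List FGSymbol) (m N : ℕ) (hN : τ.count q m w ≤ N) :
    ∃ q' r', Run (transduceLoop τ) ((q, w.head?, r), genStacks w.tail b m.bits [] o)
      ((q', none, r'), genStacks [] (w.reverse ++ b) (τ.count q m w).bits []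
        ((τ.out q m w).reverse ++ o)) (w.length * (5 * (7 * N + 5) + 6) + 1) := by
  induction w generalizing q r b o m with
  | nil => exact ⟨q, r, (Run.loop_false rfl).mono (by omega)⟩
  | cons x w ih =>
    obtain ⟨r₁, h₁⟩ := run_actions q (some x) r w (x :: b) o m N (τ.emit q x)
      ((τ.le_count _ _ w).trans hN)
    obtain ⟨q', r', h₂⟩ := ih (τ.next q x) r₁ (x :: b)
      ((CounterAction.out m (τ.emit q x)).reverse ++ o) (CounterAction.next m (τ.emit q x)) hN
    refine ⟨q', r', ?_⟩
    have h := (run_pushBack (q, some x, r) w b m.bits [] o regSym).seq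
      ((Run.dispatch (f := fun v => actions (τ.emit v.1 (regSym v))) h₁).seq
        ((Run.load (fun v => (τ.next v.1 (regSym v), v.2)) _ _).seq
          (run_popInp _ (some x) r₁ w _ _ _ _)))
    have h' := Run.loop_true rfl h h₂
    have ht : (τ.emit q x).length * (7 * N + 5) ≤ 5 * (7 * N + 5) :=
      Nat.mul_le_mul_right _ (τ.length_emit q x)
    simpa [transduceLoop, CounterTransducer.out, CounterTransducer.count] using h'.mono
      (show _ ≤ (w.length + 1) * (5 * (7 * N + 5) + 6) + 1 by rw [add_mul]; omega)

/-- Runs a transducer on the input and restores the input. -/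
def transduce (τ : CounterTransducer Q) : Prog GenAlphabet (GenReg Q) :=
  .seq (.load fun v => (τ.start, v.2)) <| .seq (pushCnt fun _ => true) <|
    .seq (pushCnt fun _ => false) <| .seq popInp <| .seq (transduceLoop τ) <|
      .seq clearCnt rewind

theorem run_transduce (τ : CounterTransducer Q) (v : GenReg Q) (w : List OVSymbol)
    (o : List FGSymbol) :
    ∃ v', Run (transduce τ) (v, genStacks w [] [] [] o)
      (v', genStacks w [] [] [] ((τ.out τ.start 2 w).reverse ++ o))
      (200 * (w.length + 1) ^ 2) := by
  obtain ⟨q, s, r⟩ := v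
  have hN := τ.count_le τ.start 2 w
  obtain ⟨q', r', h⟩ := run_transduceLoop τ τ.start r w [] o 2 _ hN
  -- The two initial pushes leave exactly these digits, least significant on top.
  have h2 : Nat.bits 2 = [false, true] := by simp [Nat.bits, Nat.binaryRec]
  rw [h2] at h
  have h' := (Run.load (fun v : GenReg Q => (τ.start, v.2)) (q, s, r) (genStacks w [] [] [] o)).seq
    ((run_pushCnt _ w [] [] [] o fun _ => true).seq
      ((run_pushCnt _ w [] [true] [] o fun _ => false).seq
        ((run_popInp τ.start s r w [] [false, true] [] o).seq
          (h.seq ((run_clearCnt _ _ _ _ _ _ _ _).seq (run_rewind _ _ _ _ _ _ _ _))))))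
  refine ⟨(q', none, none), ?_⟩
  have hb := (length_bits_le (τ.count τ.start 2 w)).trans hN
  simpa [transduce] using h'.mono (show _ ≤ 200 * (w.length + 1) ^ 2 by
    simp only [List.length_append, List.length_reverse, List.length_nil]
    nlinarith)

/-- Writes segments one after the other. -/
def segments : List (Segment Q) → Prog GenAlphabet (GenReg Q)
  | [] => .load id
  | .lit l :: L => .seq (actions (l.map .lit)) (segments L)
  | .pass τ :: L => .seq (transduce τ) (segments L)

theorem run_segments (L : List (Segment Q)) : ∃ C, ∀ (v : GenReg Q) (w : List OVSymbol)
    (o : List FGSymbol), ∃ v', Run (segments L) (v, genStacks w [] [] [] o)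
      (v', genStacks w [] [] [] ((L.flatMap (Segment.out w)).reverse ++ o))
      (C * (w.length + 1) ^ 2) := by
  induction L with
  | nil =>
    refine ⟨1, fun v w o => ⟨v, (Run.load id _ _).mono ?_⟩⟩
    have := Nat.one_le_pow 2 (w.length + 1) (by omega)
    omega
  | cons x L ih =>
    obtain ⟨C, hC⟩ := ih
    cases x with
    | lit l =>
      refine ⟨l.length * 5 + 1 + C, fun v w o => ?_⟩
      -- Literals leave the counter alone; the empty counter counts as `0`, so `N = 0` will do.
      obtain ⟨r, h⟩ := run_actions v.1 v.2.1 v.2.2 w [] o 0 0 (l.map .lit)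
        (by rw [CounterAction.next_map_lit])
      rw [CounterAction.next_map_lit, CounterAction.out_map_lit] at h
      obtain ⟨v', h'⟩ := hC (v.1, v.2.1, r) w (l.reverse ++ o)
      refine ⟨v', ?_⟩
      have := Nat.one_le_pow 2 (w.length + 1) (by omega)
      simpa [segments, Segment.out] using (h.seq h').mono
        (show _ ≤ (l.length * 5 + 1 + C) * (w.length + 1) ^ 2 by
          rw [List.length_map, add_mul]
          nlinarith)
    | pass τ =>
      refine ⟨200 + C, fun v w o => ?_⟩
      obtain ⟨v₁, h⟩ := run_transduce τ v w o
      obtain ⟨v', h'⟩ := hC v₁ w ((τ.out τ.start 2 w).reverse ++ o)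
      refine ⟨v', ?_⟩
      simpa [segments, Segment.out] using (h.seq h').mono
        (show _ ≤ (200 + C) * (w.length + 1) ^ 2 by rw [add_mul])

/-- Writes segments one after the other, empties the input and resets the register. -/
def generate (v₀ : GenReg Q) (L : List (Segment Q)) : Prog GenAlphabet (GenReg Q) :=
  .seq (segments L) (.seq clearInp (.load fun _ => v₀))

theorem run_generate (v₀ : GenReg Q) (L : List (Segment Q)) : ∃ C, ∀ w : List OVSymbol,
    Run (generate v₀ L) (v₀, genStacks w [] [] [] [])
      (v₀, genStacks [] [] [] [] (L.flatMap (Segment.out w)).reverse)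
      (C * (w.length + 1) ^ 2) := by
  obtain ⟨C, hC⟩ := run_segments L
  refine ⟨C + 3, fun w => ?_⟩
  obtain ⟨v', h⟩ := hC v₀ w []
  simpa [generate] using (h.seq ((run_clearInp v'.1 v'.2.1 v'.2.2 w [] [] [] _).seq
    (Run.load (fun _ => v₀) _ _))).mono
    (show _ ≤ (C + 3) * (w.length + 1) ^ 2 by nlinarith)

end Prog

instance : Inhabited FGSymbol := ⟨.comma⟩

/-- A machine that answers questions about words that are written by segments yields a machine that
answers them about the inputs. -/
theorem exists_answersInTime_of_segments {Q : Type} [Fintype Q] [Inhabited Q]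
    (L : List (Segment Q)) (M : Turing.TM2ComputableAux FGSymbol Bool) :
    ∃ (M' : Turing.TM2ComputableAux OVSymbol Bool) (C : ℕ), ∀ (w : List OVSymbol) (P : Prop) (T : ℝ),
      AnswersInTime M (L.flatMap (Segment.out w)) P T →
        AnswersInTime M' w P (C * ((w.length : ℝ) + 1) ^ 2 + T) := by
  obtain ⟨C, hC⟩ := Prog.run_generate (default, none, none) L
  have hi : ∀ w, Function.update (fun k => ([] : List (GenAlphabet k))) GenStack.inp w =
      genStacks w [] [] [] [] := fun w => by funext k; cases k <;> rfl
  have ho : ∀ u, Function.update (fun k => ([] : List (GenAlphabet k))) GenStack.out u =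
      genStacks [] [] [] [] u := fun w => by funext k; cases k <;> rfl
  refine ⟨Prog.composeTM (Γ := GenAlphabet) (Prog.generate (default, none, none) L) GenStack.inp GenStack.out
    (default, none, none) M, 2 * C + 1, fun w P T h => ?_⟩
  have hw := hC w
  rw [← hi, ← ho] at hw
  obtain ⟨b, hb, t, ht, h'⟩ := Prog.answersInTime_composeTM (kin := GenStack.inp) (kout := GenStack.out)
    (by decide) M hw h
  refine ⟨b, hb, t, ht.trans ?_, h'⟩
  push_cast
  nlinarith [show (0 : ℝ) ≤ w.length from Nat.cast_nonneg _]

/-! ### The graphs that select and scan a vector of a family -/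

section Scan

variable {K : ℕ}

/-- The state of a scan after a symbol: the number of the current family, and whether a vector
starts. -/
def scanNext (q : Fin (K + 1) × Bool) : OVSymbol → Fin (K + 1) × Bool
  | .bit _ => (q.1, false)
  | .endVector => (q.1, true)
  | .endSet => (q.1 + 1, true)

variable (i j : Fin K)

/-- The edges that belong to the symbol at position `m` in the graph that selects and scans a vector
of the family `j`. For `i = j` the coordinates of the vector have to be zero. -/
def symbolEdges (q : Fin (K + 1) × Bool) (m : ℕ) : OVSymbol → List (ℕ × ℕ)
  | .bit b =>
      (if q = (j.castSucc, true) then [(0, m)] else []) ++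
        (if i ≠ j ∨ b = false then [(m, m + 1)] else [])
  | .endVector => [(m, 1)]
  | .endSet => []

/-- The edges that belong to the symbols of a word that starts at position `m`. -/
def scanEdges : Fin (K + 1) × Bool → ℕ → List OVSymbol → List (ℕ × ℕ)
  | _, _, [] => []
  | q, m, a :: w => symbolEdges i j q m a ++ scanEdges (scanNext q a) (m + 1) w

variable {i j}

theorem fst_of_mem_symbolEdges {q : Fin (K + 1) × Bool} {m : ℕ} {a : OVSymbol} {e : ℕ × ℕ}
    (h : e ∈ symbolEdges i j q m a) : e = (0, m) ∨ e.1 = m ∧ e.2 ≤ max (m + 1) 1 := by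
  cases a <;> simp only [symbolEdges, List.mem_append, List.mem_ite_nil_right,
    List.mem_singleton, List.not_mem_nil] at h
  · rcases h with ⟨_, rfl⟩ | ⟨_, rfl⟩ <;> simp
  · subst h; simp

/-- Every edge reveals its position: by its head if it leaves `0`, by its tail otherwise. Hence
different symbols contribute different edges, and all edges stay among the vertices. -/
theorem bounds_of_mem_scanEdges {q : Fin (K + 1) × Bool} {m : ℕ} {w : List OVSymbol} {e : ℕ × ℕ}
    (h : e ∈ scanEdges i j q m w) :
    (e.1 = 0 ∧ m ≤ e.2 ∨ m ≤ e.1) ∧ e.1 < m + w.length ∧ e.2 ≤ m + w.length := by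
  induction w generalizing q m with
  | nil => simp [scanEdges] at h
  | cons a w ih =>
    rw [scanEdges, List.mem_append] at h
    rw [List.length_cons]
    rcases h with h | h
    · rcases fst_of_mem_symbolEdges h with rfl | ⟨h₁, h₂⟩
      · simp
      · omega
    · have := ih h
      omega

theorem nodup_scanEdges (q : Fin (K + 1) × Bool) {m : ℕ} (hm : 0 < m) (w : List OVSymbol) :
    (scanEdges i j q m w).Nodup := by
  induction w generalizing q m with
  | nil => exact List.nodup_nil
  | cons a w ih =>
    rw [scanEdges, List.nodup_append]
    refine ⟨?_, ih _ (by omega), ?_⟩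
    · cases a with
      | bit b => rw [symbolEdges]; split_ifs <;> simp [hm.ne]
      | endVector => simp [symbolEdges]
      | endSet => simp [symbolEdges]
    · rintro e he e' he' rfl
      have h' := (bounds_of_mem_scanEdges he').1
      rcases fst_of_mem_symbolEdges he with rfl | ⟨h₁, -⟩
      · simp at h'
      · omega

/-- The state of the scan matters only for edges that leave `0`; the edges at any other vertex
depend on the symbol there alone. -/
theorem mem_scanEdges_add (q : Fin (K + 1) × Bool) {m : ℕ} (hm : 0 < m) (w : List OVSymbol)
    (x y : ℕ) :
    (x + m, y) ∈ scanEdges i j q m w ↔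
      (∃ b, w[x]? = some (.bit b) ∧ (i ≠ j ∨ b = false) ∧ y = x + m + 1) ∨
        w[x]? = some .endVector ∧ y = 1 := by
  induction w generalizing q m x with
  | nil => simp [scanEdges]
  | cons a w ih =>
    rw [scanEdges, List.mem_append]
    cases x with
    | zero =>
      have h : (m, y) ∉ scanEdges i j (scanNext q a) (m + 1) w := fun h => by
        have := (bounds_of_mem_scanEdges h).1
        simp only at this
        omega
      rw [zero_add]
      cases a with
      | bit b =>
        simp [h, symbolEdges, hm.ne']
      | endVector => simp [h, symbolEdges]
      | endSet => simp [h, symbolEdges]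
    | succ x =>
      have h : (x + 1 + m, y) ∉ symbolEdges i j q m a := fun h => by
        rcases fst_of_mem_symbolEdges h with h | ⟨h, -⟩
        · simp only [Prod.mk.injEq] at h; omega
        · simp only at h; omega
      have e : x + 1 + m = x + (m + 1) := by omega
      rw [e] at h ⊢
      rw [or_iff_right h, ih _ (by omega)]
      simp

theorem scanEdges_append (q : Fin (K + 1) × Bool) (m : ℕ) (u w : List OVSymbol) :
    scanEdges i j q m (u ++ w) =
      scanEdges i j q m u ++ scanEdges i j (u.foldl scanNext q) (m + u.length) w := by
  induction u generalizing q m with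
  | nil => simp [scanEdges]
  | cons a u ih =>
    simp only [List.cons_append, scanEdges, ih, List.foldl_cons, List.length_cons,
      List.append_assoc]
    rw [show m + 1 + u.length = m + (u.length + 1) by omega]

/-- A vector as a word. -/
def vectorWord (v : List Bool) : List OVSymbol := v.map .bit ++ [.endVector]

theorem foldl_scanNext_vectorWord (q : Fin (K + 1) × Bool) (v : List Bool) :
    (vectorWord v).foldl scanNext q = (q.1, true) := by
  rw [vectorWord, List.foldl_append]
  have : ((v.map OVSymbol.bit).foldl scanNext q).1 = q.1 := by
    induction v generalizing q with
    | nil => rfl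
    | cons b v ih => exact ih (q.1, false)
  simp [scanNext, this]

theorem foldl_scanNext_flatMap_vectorWord (f : Fin (K + 1)) (L : List (List Bool)) :
    (L.flatMap vectorWord).foldl scanNext (f, true) = (f, true) := by
  induction L with
  | nil => rfl
  | cons v L ih =>
    rw [List.flatMap_cons, List.foldl_append, foldl_scanNext_vectorWord, ih]

theorem zero_mem_scanEdges_vectorWord (f : Fin (K + 1)) {m : ℕ} (hm : 0 < m) {v : List Bool}
    (hv : v ≠ []) (y : ℕ) :
    (0, y) ∈ scanEdges i j (f, true) m (vectorWord v) ↔ f = j.castSucc ∧ y = m := by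
  -- Inside a vector the flag is `false`, so only its first coordinate receives an edge from `0`. A
  -- vector of dimension zero would receive none.
  have key : ∀ (v : List Bool) (m : ℕ), 0 < m →
      (0, y) ∉ scanEdges i j (f, false) m (vectorWord v) := by
    intro v
    induction v with
    | nil => intro m hm; simp [vectorWord, scanEdges, symbolEdges, hm.ne]
    | cons b v ih =>
      intro m hm
      have := ih (m + 1) (by omega)
      rw [vectorWord] at this
      simp [vectorWord, scanEdges, symbolEdges, hm.ne, scanNext, this]
  obtain _ | ⟨b, v⟩ := v
  · exact absurd rfl hv
  · have := key v (m + 1) (by omega)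
    rw [vectorWord] at this
    simp [vectorWord, scanEdges, symbolEdges, hm.ne, scanNext, this]

theorem length_flatMap_of_length {α β : Type} {g : α → List β} {B : ℕ} (L : List α)
    (hg : ∀ x ∈ L, (g x).length = B) : (L.flatMap g).length = L.length * B := by
  induction L with
  | nil => simp
  | cons a L ih =>
    rw [List.flatMap_cons, List.length_append, hg a (by simp), ih fun x hx => hg x (by simp [hx]),
      List.length_cons, add_mul]
    omega

theorem getElem?_flatMap_of_length {α β : Type} {g : α → List β} {B : ℕ} (L : List α)
    (hg : ∀ x ∈ L, (g x).length = B) {t : ℕ} (ht : t < L.length) {r : ℕ} (hr : r < B) :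
    (L.flatMap g)[t * B + r]? = (g L[t])[r]? := by
  induction L generalizing t with
  | nil => simp at ht
  | cons a L ih =>
    have ha : (g a).length = B := hg a (by simp)
    rw [List.flatMap_cons]
    cases t with
    | zero => rw [zero_mul, zero_add, List.getElem?_append_left (by omega)]; rfl
    | succ t =>
      rw [List.getElem?_append_right (by rw [ha, add_mul]; omega), ha,
        show (t + 1) * B + r - B = t * B + r by rw [add_mul]; omega,
        ih (fun x hx => hg x (by simp [hx])) (by simpa using ht)]
      simp

theorem zero_mem_scanEdges_family (f : Fin (K + 1)) {m d : ℕ} (hm : 0 < m) (hd : 0 < d)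
    (L : List (List Bool)) (hL : ∀ v ∈ L, v.length = d) (y : ℕ) :
    (0, y) ∈ scanEdges i j (f, true) m (L.flatMap vectorWord) ↔
      f = j.castSucc ∧ ∃ t < L.length, y = m + t * (d + 1) := by
  induction L generalizing m with
  | nil => simp [scanEdges]
  | cons v L ih =>
    have hv : v.length = d := hL v (by simp)
    have hl : (vectorWord v).length = d + 1 := by simp [vectorWord, hv]
    have hne : v ≠ [] := by rintro rfl; simp at hv; omega
    rw [List.flatMap_cons, scanEdges_append, List.mem_append,
      zero_mem_scanEdges_vectorWord f hm hne, foldl_scanNext_vectorWord, hl,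
      ih (by omega) (fun v hv => hL v (by simp [hv])), ← and_or_left]
    refine and_congr_right fun _ => ⟨?_, ?_⟩
    · rintro (rfl | ⟨t, ht, rfl⟩)
      · exact ⟨0, by simp, by simp⟩
      · exact ⟨t + 1, by simpa using ht, by ring⟩
    · rintro ⟨_ | t, ht, rfl⟩
      · simp
      · exact .inr ⟨t, by simpa using ht, by ring⟩

/-- A family of vectors as a word. -/
def familyWord (L : List (List Bool)) : List OVSymbol := L.flatMap vectorWord ++ [.endSet]

theorem length_familyWord {d : ℕ} (L : List (List Bool)) (hL : ∀ v ∈ L, v.length = d) :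
    (familyWord L).length = L.length * (d + 1) + 1 := by
  rw [familyWord, List.length_append, length_flatMap_of_length (B := d + 1)]
  · rfl
  · intro v hv
    simp [vectorWord, hL v hv]

/-- Here `c` families have already been read. The bound `c + F.length ≤ K` keeps the cyclic counter
in `Fin (K + 1)` from wrapping around before the word ends, so that comparison with `j.castSucc`
identifies the family. -/
theorem zero_mem_scanEdges_families {m n d : ℕ} (hm : 0 < m) (hd : 0 < d)
    (F : List (List (List Bool))) (hF : ∀ L ∈ F, L.length = n ∧ ∀ v ∈ L, v.length = d) (c : ℕ)
    (hc : c + F.length ≤ K) (y : ℕ) :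
    (0, y) ∈ scanEdges i j (Fin.ofNat (K + 1) c, true) m (F.flatMap familyWord) ↔
      ∃ s < F.length, c + s = j ∧ ∃ t < n, y = m + s * (n * (d + 1) + 1) + t * (d + 1) := by
  induction F generalizing m c with
  | nil => simp [scanEdges]
  | cons L F ih =>
    obtain ⟨hn, hv⟩ := hF L (by simp)
    rw [List.length_cons] at hc
    have hnext : (familyWord L).foldl scanNext (Fin.ofNat (K + 1) c, true) =
        (Fin.ofNat (K + 1) (c + 1), true) := by
      rw [familyWord, List.foldl_append, foldl_scanNext_flatMap_vectorWord]
      simp [scanNext, Fin.ext_iff, Fin.val_add]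
    have hcj : Fin.ofNat (K + 1) c = j.castSucc ↔ c = j := by
      rw [Fin.ext_iff, Fin.val_ofNat, Nat.mod_eq_of_lt (by omega), Fin.val_castSucc]
    have hfam : (0, y) ∈ scanEdges i j (Fin.ofNat (K + 1) c, true) m (familyWord L) ↔
        c = j ∧ ∃ t < n, y = m + t * (d + 1) := by
      rw [familyWord, scanEdges_append, List.mem_append, zero_mem_scanEdges_family _ hm hd L hv, hcj,
        hn]
      simp [scanEdges, symbolEdges]
    rw [List.flatMap_cons, scanEdges_append, List.mem_append, hfam, hnext, length_familyWord L hv, hn,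
      ih (by omega) (fun L hL => hF L (by simp [hL])) (c + 1) (by omega)]
    constructor
    · rintro (⟨h, t, ht, rfl⟩ | ⟨s, hs, h, t, ht, rfl⟩)
      · exact ⟨0, by simp, by simpa using h, t, ht, by ring⟩
      · exact ⟨s + 1, by simpa using hs, by omega, t, ht, by ring⟩
    · rintro ⟨_ | s, hs, h, t, ht, rfl⟩
      · exact .inl ⟨by simpa using h, t, ht, by ring⟩
      · exact .inr ⟨s, by simpa using hs, by omega, t, ht, by ring⟩

end Scan

/-! ### Positions in the encoding of an instance of orthogonal vectors -/

namespace OVInstance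

variable {K : ℕ} (I : OVInstance K)

/-- The position of a coordinate in the encoding; `l = d` stands for the end of the vector. -/
def position (f j l : ℕ) : ℕ := f * (I.n * (I.d + 1) + 1) + (j * (I.d + 1) + l)

/-- The families as lists of lists of bits. -/
def families : List (List (List Bool)) :=
  (List.finRange K).map fun f => (List.finRange I.n).map fun j => (List.finRange I.d).map (I.vec f j)

theorem encode_eq : I.encode = I.families.flatMap familyWord := by
  simp [encode, families, List.flatMap_map, familyWord, vectorWord, Function.comp_def]

theorem length_of_mem_families : ∀ L ∈ I.families, L.length = I.n ∧ ∀ v ∈ L, v.length = I.d := by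
  intro L hL
  simp only [families, List.mem_map] at hL
  obtain ⟨f, -, rfl⟩ := hL
  refine ⟨by simp, fun v hv => ?_⟩
  obtain ⟨j, -, rfl⟩ := List.mem_map.1 hv
  simp

theorem length_families : I.families.length = K := by simp [families]

theorem length_encode : I.encode.length = K * (I.n * (I.d + 1) + 1) := by
  rw [encode_eq, length_flatMap_of_length (B := I.n * (I.d + 1) + 1), length_families]
  intro L hL
  obtain ⟨hn, hv⟩ := I.length_of_mem_families L hL
  rw [length_familyWord L hv, hn]

theorem getElem?_encode (f : Fin K) (j : Fin I.n) {l : ℕ} (hl : l < I.d + 1) :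
    I.encode[I.position f j l]? = (vectorWord ((List.finRange I.d).map (I.vec f j)))[l]? := by
  have h : j * (I.d + 1) + l < I.n * (I.d + 1) := by
    have := Nat.mul_le_mul_right (I.d + 1) (show (j : ℕ) + 1 ≤ I.n from j.2)
    rw [add_mul] at this
    omega
  rw [encode_eq, position, getElem?_flatMap_of_length (B := I.n * (I.d + 1) + 1) _ _
    (by simp [families]) (by omega), familyWord, List.getElem?_append_left,
    getElem?_flatMap_of_length (B := I.d + 1) _ _ (by simp [families]) hl]
  · simp [families]
  · simp [families, vectorWord]
  · rw [length_flatMap_of_length (B := I.d + 1)]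
    · simpa [families] using h
    · simp [families, vectorWord]
  · intro L hL
    obtain ⟨hn, hv⟩ := I.length_of_mem_families L hL
    rw [length_familyWord L hv, hn]

theorem getElem?_encode_bit (f : Fin K) (j : Fin I.n) (l : Fin I.d) :
    I.encode[I.position f j l]? = some (.bit (I.vec f j l)) := by
  rw [getElem?_encode _ _ _ (by omega), vectorWord, List.getElem?_append_left (by simp)]
  simp

theorem getElem?_encode_endVector (f : Fin K) (j : Fin I.n) :
    I.encode[I.position f j I.d]? = some .endVector := by
  rw [getElem?_encode _ _ _ (by omega), vectorWord, List.getElem?_append_right (by simp)]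
  simp

end OVInstance

/-! ### Tensor products and unions of lists of graphs -/

namespace FactoredGraph

/-- A vertex with a loop. -/
def loopGraph : InputGraph where
  verts := [0]
  edges := [(0, 0)]
  verts_nodup := by simp
  edges_nodup := by simp
  edges_mem := by simp

/-- The graph without vertices. -/
def emptyGraph : InputGraph where
  verts := []
  edges := []
  verts_nodup := by simp
  edges_nodup := by simp
  edges_mem := by simp

variable {ι : Type}

/-- The tensor product of a family of graphs, with a loop as the last factor. -/
def tensorFamily (G : ι → InputGraph) (L : List ι) : FactoredGraph :=
  L.foldr (fun i F => tensor (input (G i)) F) (input loopGraph)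

/-- The union of a list of graphs and a further graph. -/
def unionList (L : List FactoredGraph) (B : FactoredGraph) : FactoredGraph :=
  L.foldr union B

/-- A union of graphs without vertices. -/
def padding : ℕ → FactoredGraph
  | 0 => input emptyGraph
  | p + 1 => union (input emptyGraph) (padding p)

/-- The vertex of a tensor product with given components. -/
def tuple (L : List ι) (u : ι → ℕ) : List ℕ := L.map u ++ [0]

theorem tuple_mem_V_tensorFamily {G : ι → InputGraph} {L : List ι} {u : ι → ℕ}
    (h : ∀ i ∈ L, u i ∈ (G i).verts) : tuple L u ∈ (tensorFamily G L).V := by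
  induction L with
  | nil => exact ⟨0, by simp [loopGraph], rfl⟩
  | cons i L ih =>
    exact ⟨[u i], ⟨u i, h i (by simp), rfl⟩, tuple L u, ih fun j hj => h j (by simp [hj]), rfl⟩

theorem edge_tensorFamily {G : ι → InputGraph} {L : List ι} {u u' : ι → ℕ}
    (h : ∀ i ∈ L, (u i, u' i) ∈ (G i).edges) :
    (tensorFamily G L).Edge (tuple L u) (tuple L u') := by
  induction L with
  | nil => exact ⟨(0, 0), by simp [loopGraph], rfl, rfl⟩
  | cons i L ih =>
    exact ⟨[u i], [u' i], tuple L u, tuple L u', ⟨_, h i (by simp), rfl, rfl⟩,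
      ih fun j hj => h j (by simp [hj]), rfl, rfl⟩

/-- Each component is a single number, so a flattened tuple splits in only one way. Without `hL`,
two factors with the same index could move to different vertices, and no function `u'` would
describe the result. -/
theorem exists_of_edge_tensorFamily [DecidableEq ι] {G : ι → InputGraph} {L : List ι}
    (hL : L.Nodup) {u : ι → ℕ} {y : List ℕ} (h : (tensorFamily G L).Edge (tuple L u) y) :
    ∃ u', y = tuple L u' ∧ ∀ i ∈ L, (u i, u' i) ∈ (G i).edges := by
  induction L generalizing y with
  | nil =>
    obtain ⟨e, he, -, rfl⟩ := h
    obtain rfl : e = (0, 0) := by simpa [loopGraph] using he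
    exact ⟨u, rfl, by simp⟩
  | cons i L ih =>
    obtain ⟨-, -, b, b', ⟨e, he, rfl, rfl⟩, hb, hx, rfl⟩ := h
    obtain ⟨hi, hL⟩ := List.nodup_cons.1 hL
    obtain ⟨he₁, rfl⟩ : u i = e.1 ∧ tuple L u = b := by simpa [tuple] using hx
    obtain ⟨u', rfl, h'⟩ := ih hL hb
    refine ⟨Function.update u' i e.2, ?_, ?_⟩
    · have : L.map (Function.update u' i e.2) = L.map u' := List.map_congr_left fun j hj =>
        Function.update_of_ne (by rintro rfl; exact hi hj) _ _
      simp [tuple, this]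
    · intro j hj
      rcases eq_or_ne j i with rfl | hne
      · simpa [he₁] using he
      · rw [Function.update_of_ne hne]
        exact h' j ((List.mem_cons.1 hj).resolve_left hne)

theorem not_edge_padding (p : ℕ) (x y : List ℕ) : ¬ (padding p).Edge x y := by
  induction p with
  | zero => simp [padding, Edge, emptyGraph]
  | succ p ih => simp [padding, Edge, emptyGraph, ih]

theorem mem_V_unionList {L : List FactoredGraph} {B F : FactoredGraph} (hF : F ∈ L) {x : List ℕ}
    (hx : x ∈ F.V) : x ∈ (unionList L B).V := by
  induction L with
  | nil => simp at hF
  | cons F' L ih =>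
    rcases List.mem_cons.1 hF with rfl | hF
    · exact .inl hx
    · exact .inr (ih hF)

theorem edge_unionList {L : List FactoredGraph} {B : FactoredGraph} {x y : List ℕ} :
    (unionList L B).Edge x y ↔ (∃ F ∈ L, F.Edge x y) ∨ B.Edge x y := by
  induction L with
  | nil => simp [unionList]
  | cons F L ih =>
    show F.Edge x y ∨ (unionList L B).Edge x y ↔ _
    rw [ih]
    simp [or_assoc]

theorem numOps_tensorFamily (G : ι → InputGraph) (L : List ι) :
    (tensorFamily G L).numOps = L.length := by
  induction L with
  | nil => rfl
  | cons i L ih =>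
    rw [tensorFamily, List.foldr_cons, numOps, ← tensorFamily, ih]
    simp [numOps]

theorem numOps_padding (p : ℕ) : (padding p).numOps = p := by
  induction p with
  | zero => rfl
  | succ p ih => simp [padding, numOps, ih]

theorem numOps_unionList {L : List FactoredGraph} {B : FactoredGraph} {m : ℕ}
    (h : ∀ F ∈ L, F.numOps = m) : (unionList L B).numOps = L.length * (m + 1) + B.numOps := by
  induction L with
  | nil => simp [unionList]
  | cons F L ih =>
    rw [unionList, List.foldr_cons, numOps, ← unionList, ih fun F hF => h F (by simp [hF]),
      h F (by simp), List.length_cons]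
    ring

theorem mem_inputs_tensorFamily {G : ι → InputGraph} {L : List ι} {H : InputGraph}
    (h : H ∈ (tensorFamily G L).inputs) : H = loopGraph ∨ ∃ i, H = G i := by
  induction L with
  | nil => exact .inl (by simpa [tensorFamily, inputs] using h)
  | cons i L ih =>
    rw [tensorFamily, List.foldr_cons, inputs, ← tensorFamily, List.mem_append] at h
    rcases h with h | h
    · exact .inr ⟨i, by simpa [inputs] using h⟩
    · exact ih h

theorem mem_inputs_padding {p : ℕ} {H : InputGraph} (h : H ∈ (padding p).inputs) :
    H = emptyGraph := by
  induction p with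
  | zero => simpa [padding, inputs] using h
  | succ p ih =>
    rw [padding, inputs, List.mem_append] at h
    exact h.elim (fun h => by simpa [inputs] using h) ih

theorem mem_inputs_unionList {L : List FactoredGraph} {B : FactoredGraph} {H : InputGraph}
    (h : H ∈ (unionList L B).inputs) : (∃ F ∈ L, H ∈ F.inputs) ∨ H ∈ B.inputs := by
  induction L with
  | nil => exact .inr h
  | cons F L ih =>
    rw [unionList, List.foldr_cons, inputs, ← unionList, List.mem_append] at h
    rcases h with h | h
    · exact .inl ⟨F, by simp, h⟩
    · exact (ih h).imp_left fun ⟨F, hF, h⟩ => ⟨F, by simp [hF], h⟩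

theorem encode_tensorFamily (G : ι → InputGraph) (L : List ι) :
    (tensorFamily G L).encode =
      L.flatMap (fun i => .tensor :: .input :: (G i).encode) ++ (input loopGraph).encode := by
  induction L with
  | nil => simp [tensorFamily]
  | cons i L ih =>
    show .tensor :: ((input (G i)).encode ++ (tensorFamily G L).encode) = _
    rw [ih]
    simp [encode]

theorem encode_unionList (L : List FactoredGraph) (B : FactoredGraph) :
    (unionList L B).encode = L.flatMap (fun F => .union :: F.encode) ++ B.encode := by
  induction L with
  | nil => simp [unionList]
  | cons F L ih =>
    rw [unionList, List.foldr_cons, encode, ← unionList, ih]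
    simp

end FactoredGraph

/-! ### The reduction -/

section Reduction

open FactoredGraph

variable {K : ℕ}

/-- The graph that selects and scans a vector of the family `j`: the vertex `0` is the source, the
vertex `1` the target, and the vertex `p + 2` stands for the position `p` of the word. -/
def scanGraph (w : List OVSymbol) (i j : Fin K) : InputGraph where
  verts := List.range (w.length + 3)
  edges := scanEdges i j (0, true) 2 w
  verts_nodup := List.nodup_range
  edges_nodup := nodup_scanEdges _ (by omega) w
  edges_mem e he := by
    have := (bounds_of_mem_scanEdges he).2
    simp only [List.mem_range]
    omega

/-- The graph in which a step passes a coordinate at which the vector of the family `i` is zero. -/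
def termGraph (w : List OVSymbol) (i : Fin K) : FactoredGraph :=
  tensorFamily (scanGraph w i) (List.finRange K)

/-- The graph in which a step passes a coordinate at which one of the vectors is zero. -/
def reductionGraph (K p : ℕ) (w : List OVSymbol) : FactoredGraph :=
  unionList ((List.finRange K).map (termGraph w)) (padding p)

/-- Each of the `K` terms has `K` scans and a loop as inputs, and the padding adds `p + 1` empty
graphs. -/
theorem hasComplexity_reductionGraph (p : ℕ) (w : List OVSymbol) :
    (reductionGraph K p w).HasComplexity (w.length + 3) (K * (K + 1) + p + 1) := by
  constructor
  · rw [reductionGraph, numOps_unionList (m := K), numOps_padding]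
    · simp
    · simp only [List.mem_map]
      rintro _ ⟨i, -, rfl⟩
      rw [termGraph, numOps_tensorFamily, List.length_finRange]
  · intro H hH
    have hlt : ∀ v < w.length + 3, v < (w.length + 3) * (K * (K + 1) + p + 1) := fun v hv =>
      hv.trans_le (Nat.le_mul_of_pos_right _ (by omega))
    rcases mem_inputs_unionList hH with ⟨F, hF, hH⟩ | hH
    · obtain ⟨i, -, rfl⟩ := List.mem_map.1 hF
      rcases mem_inputs_tensorFamily hH with rfl | ⟨j, rfl⟩
      · simp [loopGraph]
      · exact ⟨by simp [scanGraph], fun v hv => hlt v (by simpa [scanGraph] using hv)⟩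
    · rw [mem_inputs_padding hH]
      simp [emptyGraph]

/-- The instance of reachability that belongs to a word. -/
def reductionInstance (hK : 0 < K) (p : ℕ) (w : List OVSymbol) : ReachInstance where
  graph := reductionGraph K p w
  source := tuple (List.finRange K) fun _ => 0
  target := tuple (List.finRange K) fun _ => 1
  source_mem := mem_V_unionList (List.mem_map.2 ⟨⟨0, hK⟩, by simp, rfl⟩)
    (tuple_mem_V_tensorFamily (by simp [scanGraph]))
  target_mem := mem_V_unionList (List.mem_map.2 ⟨⟨0, hK⟩, by simp, rfl⟩)
    (tuple_mem_V_tensorFamily (by simp [scanGraph]))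

theorem tuple_finRange_inj {u u' : Fin K → ℕ} :
    tuple (List.finRange K) u = tuple (List.finRange K) u' ↔ u = u' := by
  simp [tuple, funext_iff]

theorem edge_reductionGraph {p : ℕ} {w : List OVSymbol} {u : Fin K → ℕ} {y : List ℕ} :
    (reductionGraph K p w).Edge (tuple (List.finRange K) u) y ↔
      ∃ u', y = tuple (List.finRange K) u' ∧
        ∃ i, ∀ j, (u j, u' j) ∈ scanEdges i j (0, true) 2 w := by
  rw [reductionGraph, edge_unionList, or_iff_left (not_edge_padding _ _ _)]
  constructor
  · rintro ⟨F, hF, h⟩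
    obtain ⟨i, -, rfl⟩ := List.mem_map.1 hF
    obtain ⟨u', hy, h⟩ := exists_of_edge_tensorFamily (List.nodup_finRange K) h
    exact ⟨u', hy, i, fun j => h j (by simp)⟩
  · rintro ⟨u', rfl, i, h⟩
    exact ⟨_, List.mem_map.2 ⟨i, by simp, rfl⟩, edge_tensorFamily fun j _ => h j⟩

/-! ### Correctness of the reduction -/

namespace OVInstance

variable (I : OVInstance K)

theorem zero_mem_scanEdges_encode (i j : Fin K) (y : ℕ) :
    (0, y) ∈ scanEdges i j (0, true) 2 I.encode ↔ ∃ t : Fin I.n, y = I.position j t 0 + 2 := by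
  have h := zero_mem_scanEdges_families (i := i) (j := j) (m := 2) (by omega) I.d_pos I.families
    I.length_of_mem_families 0 (by rw [length_families]; omega) y
  rw [encode_eq]
  refine h.trans ⟨?_, ?_⟩
  · rintro ⟨s, -, hs, t, ht, rfl⟩
    obtain rfl : s = j := by omega
    exact ⟨⟨t, ht⟩, by simp [position]; ring⟩
  · rintro ⟨t, rfl⟩
    exact ⟨j, by rw [length_families]; exact j.2, by simp, t, t.2, by simp [position]; ring⟩

theorem position_mem_scanEdges_encode (i j : Fin K) (t : Fin I.n) (l : Fin I.d) (y : ℕ) :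
    (I.position j t l + 2, y) ∈ scanEdges i j (0, true) 2 I.encode ↔
      (i = j → I.vec j t l = false) ∧ y = I.position j t (l + 1) + 2 := by
  rw [mem_scanEdges_add _ (by omega), getElem?_encode_bit]
  simp [position, imp_iff_not_or, add_assoc]

theorem position_end_mem_scanEdges_encode (i j : Fin K) (t : Fin I.n) (y : ℕ) :
    (I.position j t I.d + 2, y) ∈ scanEdges i j (0, true) 2 I.encode ↔ y = 1 := by
  rw [mem_scanEdges_add _ (by omega), getElem?_encode_endVector]
  simp

theorem hasOrthogonalTuple_iff :
    I.HasOrthogonalTuple ↔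
      ∃ t : Fin K → Fin I.n, ∀ l, ∃ i, I.vec i (t i) l = false := by
  simp [HasOrthogonalTuple, Finset.prod_eq_zero_iff, Bool.toNat_eq_zero]

theorem reachable_reductionInstance (hK : 0 < K) (p : ℕ) :
    (reductionInstance hK p I.encode).Reachable ↔ I.HasOrthogonalTuple := by
  set i₀ : Fin K := ⟨0, hK⟩
  rw [hasOrthogonalTuple_iff]
  constructor
  · intro h
    -- Invariant of a walk: all scans stand at the same coordinate `l` of fixed vectors, and every
    -- earlier coordinate has a zero. Leaving the end markers means that all coordinates have been
    -- checked; the first alternative then holds for good, whatever follows.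
    have key : ∀ y, Relation.ReflTransGen (reductionGraph K p I.encode).Edge
        (tuple (List.finRange K) fun _ => 0) y →
        (∃ t : Fin K → Fin I.n, ∀ l, ∃ i, I.vec i (t i) l = false) ∨
        (y = tuple (List.finRange K) fun _ => 0) ∨
        ∃ (t : Fin K → Fin I.n) (l : ℕ), l ≤ I.d ∧
          (y = tuple (List.finRange K) fun j => I.position j (t j) l + 2) ∧
          ∀ l' : Fin I.d, (l' : ℕ) < l → ∃ i, I.vec i (t i) l' = false := by
      intro y hy
      induction hy with
      | refl => exact .inr (.inl rfl)
      | tail _ he ih =>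
        rcases ih with h | rfl | ⟨t, l, hl, rfl, ht⟩
        · exact .inl h
        · obtain ⟨u', rfl, i, hu⟩ := edge_reductionGraph.1 he
          simp only [zero_mem_scanEdges_encode] at hu
          choose t ht using hu
          exact .inr (.inr ⟨t, 0, by omega, by rw [funext ht], by simp⟩)
        · obtain ⟨u', rfl, i, hu⟩ := edge_reductionGraph.1 he
          rcases hl.lt_or_eq with hl | rfl
          · have hu' := fun j => (I.position_mem_scanEdges_encode i j (t j) ⟨l, hl⟩ _).1 (hu j)
            refine .inr (.inr ⟨t, l + 1, hl, by rw [funext fun j => (hu' j).2], fun l' hl' => ?_⟩)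
            rcases (Nat.lt_succ_iff.1 hl').lt_or_eq with h | h
            · exact ht l' h
            · exact ⟨i, (Fin.ext h : l' = ⟨l, hl⟩) ▸ (hu' i).1 rfl⟩
          · exact .inl ⟨t, fun l => ht l l.2⟩
    -- The target is neither the source nor a tuple of positions, which are at least `2`. A
    -- component `i₀` must exist for this comparison.
    rcases key _ h with h | h | ⟨t, l, -, h, -⟩
    · exact h
    · exact absurd (congrFun (tuple_finRange_inj.1 h) i₀) (by simp)
    · have := congrFun (tuple_finRange_inj.1 h) i₀
      omega
  · rintro ⟨t, ht⟩
    have hl : ∀ l ≤ I.d, Relation.ReflTransGen (reductionGraph K p I.encode).Edge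
        (tuple (List.finRange K) fun _ => 0)
        (tuple (List.finRange K) fun j => I.position j (t j) l + 2) := by
      intro l hl
      induction l with
      | zero =>
        -- Choosing the vectors, like leaving their end markers, is possible in every term; `i₀` is
        -- an arbitrary one.
        exact .single (edge_reductionGraph.2 ⟨_, rfl, i₀, fun j =>
          (I.zero_mem_scanEdges_encode i₀ j _).2 ⟨t j, rfl⟩⟩)
      | succ l ih =>
        obtain ⟨i, hi⟩ := ht ⟨l, hl⟩
        exact (ih (by omega)).tail (edge_reductionGraph.2 ⟨_, rfl, i, fun j =>
          (I.position_mem_scanEdges_encode i j (t j) ⟨l, hl⟩ _).2 ⟨by rintro rfl; exact hi, rfl⟩⟩)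
    exact (hl I.d le_rfl).tail (edge_reductionGraph.2 ⟨_, rfl, i₀, fun j =>
      (I.position_end_mem_scanEdges_encode i₀ j (t j) _).2 rfl⟩)

end OVInstance

end Reduction

/-! ### Writing the instance of reachability -/

section Write

open FactoredGraph

variable {K : ℕ}

/-- The transducer that writes the vertices of the graphs that scan a word. -/
def vertexTransducer (K : ℕ) : CounterTransducer (Fin (K + 1) × Bool) where
  start := (0, true)
  emit _ _ := [.inc, .num]
  next := scanNext
  length_emit _ _ := by simp

/-- The transducer that writes the edges of a graph that scans a word. -/
def edgeTransducer (i j : Fin K) : CounterTransducer (Fin (K + 1) × Bool) where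
  start := (0, true)
  emit q
    | .bit b => (if q = (j.castSucc, true) then [.lit .comma, .num] else []) ++
        (if i ≠ j ∨ b = false then [.num, .inc, .num] else [.inc])
    | .endVector => [.num, .lit (.bit true), .lit .comma, .inc]
    | .endSet => [.inc]
  next := scanNext
  length_emit q a := by
    cases a
    · dsimp only; split_ifs <;> simp
    · simp
    · simp

/-- The counter is incremented before it is written, so starting from `2` the output begins with
`3`; the vertices `0`, `1`, `2` are supplied literally. -/
theorem out_vertexTransducer (q : Fin (K + 1) × Bool) (m : ℕ) (w : List OVSymbol) :
    (vertexTransducer K).out q m w = (List.range' (m + 1) w.length).flatMap encodeNumber := by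
  induction w generalizing q m with
  | nil => rfl
  | cons a w ih =>
    rw [CounterTransducer.out, ih]
    simp [vertexTransducer, CounterAction.out, CounterAction.next, List.range'_succ]

/-- Every symbol increments the counter exactly once, so the counter always equals the current
vertex. -/
theorem out_edgeTransducer (i j : Fin K) (q : Fin (K + 1) × Bool) (m : ℕ) (w : List OVSymbol) :
    (edgeTransducer i j).out q m w =
      ((scanEdges i j q m w).flatMap fun e => [e.1, e.2]).flatMap encodeNumber := by
  -- The transducer writes the constants `1` and `0` by literal symbols; `0` has no digits and is a
  -- bare comma.
  have h1 : encodeNumber 1 = [.bit true, .comma] := by simp [encodeNumber]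
  have h0 : encodeNumber 0 = [.comma] := by simp [encodeNumber]
  induction w generalizing q m with
  | nil => rfl
  | cons a w ih =>
    rw [CounterTransducer.out, ih, scanEdges, List.flatMap_append, List.flatMap_append]
    cases a with
    | bit b =>
      simp only [edgeTransducer, symbolEdges]
      split_ifs <;> simp [CounterAction.out, CounterAction.next, h0]
    | endVector => simp [edgeTransducer, symbolEdges, CounterAction.out, CounterAction.next, h1]
    | endSet => simp [edgeTransducer, symbolEdges, CounterAction.out, CounterAction.next]

/-- The segments that make up the encoding of a graph that scans a word. -/
def scanSegments (i j : Fin K) : List (Segment (Fin (K + 1) × Bool)) :=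
  [.lit ([0, 1, 2].flatMap encodeNumber), .pass (vertexTransducer K), .lit [.close],
    .pass (edgeTransducer i j), .lit [.close]]

theorem out_scanSegments (i j : Fin K) (w : List OVSymbol) :
    (scanSegments i j).flatMap (Segment.out w) = (scanGraph w i j).encode := by
  have h : List.range (w.length + 3) = [0, 1, 2] ++ List.range' 3 w.length := by
    rw [List.range_eq_range', add_comm, ← List.range'_append_1]
    rfl
  have hv : (scanGraph w i j).verts = _ := h
  rw [InputGraph.encode, hv, scanGraph]
  simp only [scanSegments, List.flatMap_cons, List.flatMap_nil, Segment.out, out_vertexTransducer,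
    out_edgeTransducer, encodeNumbers, List.flatMap_append]
  simp [edgeTransducer]

/-- The segments that make up the encoding of the instance of reachability. -/
def reductionSegments (hK : 0 < K) (p : ℕ) : List (Segment (Fin (K + 1) × Bool)) :=
  (List.finRange K).flatMap (fun i => .lit [.union] ::
    ((List.finRange K).flatMap (fun j => .lit [.tensor, .input] :: scanSegments i j) ++
      [.lit (FactoredGraph.input loopGraph).encode])) ++
  [.lit ((padding p).encode ++ encodeNumbers (reductionInstance hK p []).source ++
    encodeNumbers (reductionInstance hK p []).target)]

/-- Source and target do not depend on the word, so those for the empty word serve as literals. -/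
theorem out_reductionSegments (hK : 0 < K) (p : ℕ) (w : List OVSymbol) :
    (reductionSegments hK p).flatMap (Segment.out w) = (reductionInstance hK p w).encode := by
  rw [ReachInstance.encode]
  simp only [reductionInstance, reductionGraph, termGraph, encode_unionList,
    encode_tensorFamily, reductionSegments, List.flatMap_map, List.flatMap_append,
    List.flatMap_assoc, List.flatMap_cons, List.flatMap_nil, out_scanSegments, Segment.out,
    List.append_nil, List.append_assoc, List.cons_append, List.nil_append]

end Write

/-! ### Hardness of reachability -/

/-- An algorithm for reachability yields an algorithm for orthogonal vectors. -/
theorem ovSolvableWithSaving_of_reachability {K p : ℕ} (hK : 3 ≤ K) {r : ℝ}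
    (hr : r ≤ (K : ℝ) - 1)
    (h : ReachabilitySolvableWithExponent (K * (K + 1) + p + 1) r) : OVSolvableWithSaving K 1 := by
  obtain ⟨M, A, hM⟩ := h
  have hK' : 0 < K := by omega
  obtain ⟨M', C, hM'⟩ := exists_answersInTime_of_segments (reductionSegments hK' p) M
  refine ⟨M', (C + |A|) * (3 * K + 3) ^ (K - 1), K - 1, fun I => ?_⟩
  have h₁ := hM (reductionInstance hK' p I.encode) _ (hasComplexity_reductionGraph p I.encode)
  rw [I.reachable_reductionInstance, ← out_reductionSegments] at h₁
  obtain ⟨b, hb, t, ht, h₂⟩ := hM' I.encode _ _ h₁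
  refine ⟨b, hb, t, ht.trans ?_, h₂⟩
  have hn : (1 : ℝ) ≤ I.n := by exact_mod_cast I.n_pos
  have hd : (1 : ℝ) ≤ I.d := by exact_mod_cast I.d_pos
  have hnd : (1 : ℝ) ≤ I.n * I.d := by nlinarith
  -- The length is `K * (n * (d + 1) + 1)`, and `n * d`, `n` and `1` are all at most `n * d`.
  have hlen : ((I.encode.length + 3 : ℕ) : ℝ) ≤ (3 * K + 3) * (I.n * I.d) := by
    rw [I.length_encode]
    push_cast
    have h3 : (I.n : ℝ) * (I.d + 1) + 1 ≤ 3 * (I.n * I.d) := by nlinarith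
    nlinarith [mul_le_mul_of_nonneg_left h3 (Nat.cast_nonneg (α := ℝ) K)]
  set N : ℝ := ((I.encode.length + 3 : ℕ) : ℝ) with hN
  have hN' : N = (I.encode.length : ℝ) + 3 := by rw [hN]; push_cast; rfl
  have hl : (0 : ℝ) ≤ I.encode.length := Nat.cast_nonneg _
  have hN1 : 1 ≤ N := by linarith
  have hcast : (K : ℝ) - 1 = ((K - 1 : ℕ) : ℝ) := by
    rw [Nat.cast_sub (by omega), Nat.cast_one]
  rw [hcast] at hr ⊢
  rw [Real.rpow_natCast]
  have e₁ : N ^ r ≤ N ^ (K - 1) := by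
    rw [← Real.rpow_natCast]
    exact Real.rpow_le_rpow_of_exponent_le hN1 hr
  -- The time for writing the instance is absorbed here, by `2 ≤ K - 1`.
  have e₂ : ((I.encode.length : ℝ) + 1) ^ 2 ≤ N ^ (K - 1) :=
    (pow_le_pow_left₀ (by linarith) (by linarith) 2).trans (pow_le_pow_right₀ hN1 (by omega))
  have e₃ : N ^ (K - 1) ≤ (3 * K + 3) ^ (K - 1) * ((I.n : ℝ) ^ (K - 1) * (I.d : ℝ) ^ (K - 1)) := by
    rw [← mul_pow, ← mul_pow]
    exact pow_le_pow_left₀ (by linarith) hlen _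
  have e₄ : A * N ^ r ≤ |A| * N ^ (K - 1) :=
    (mul_le_mul_of_nonneg_right (le_abs_self A) (Real.rpow_nonneg (by linarith) r)).trans
      (mul_le_mul_of_nonneg_left e₁ (abs_nonneg A))
  calc (C : ℝ) * ((I.encode.length : ℝ) + 1) ^ 2 + A * N ^ r
      ≤ C * N ^ (K - 1) + |A| * N ^ (K - 1) :=
        add_le_add (mul_le_mul_of_nonneg_left e₂ (Nat.cast_nonneg C)) e₄
    _ = (C + |A|) * N ^ (K - 1) := by ring
    _ ≤ (C + |A|) *
        ((3 * K + 3) ^ (K - 1) * ((I.n : ℝ) ^ (K - 1) * (I.d : ℝ) ^ (K - 1))) :=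
        mul_le_mul_of_nonneg_left e₃ (add_nonneg (Nat.cast_nonneg C) (abs_nonneg A))
    _ = _ := by ring

/-- For fixed `k` the factor `g k` is a constant, and the exponent is the same for all `k`. -/
theorem ReachabilityFPT.solvableWithExponent (h : ReachabilityFPT) :
    ∃ C : ℕ, ∀ k, ReachabilitySolvableWithExponent k C := by
  obtain ⟨M, g, C, h⟩ := h
  refine ⟨C, fun k => ⟨M, g k, fun I n hI => ?_⟩⟩
  rw [Real.rpow_natCast]
  exact h I n k hI

theorem theorem3 (hOV : OVConjecture) :
    ¬ ReachabilityFPT ∧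
      ∃ c : ℝ, 0 < c ∧ ∃ k₀ : ℕ, ∀ k : ℕ, k₀ ≤ k →
        ¬ ReachabilitySolvableWithExponent k (c * (k : ℝ) ^ (1 / 3 : ℝ)) := by
  constructor
  · intro h
    obtain ⟨C, h⟩ := h.solvableWithExponent
    -- With `K = C + 3` families, `C ≤ K - 1` and `K ≥ 3`.
    exact hOV (C + 3) (by omega) 1 one_pos (ovSolvableWithSaving_of_reachability (p := 0)
      (by omega) (by push_cast; linarith) (h _))
  -- Take `K = k.sqrt - 1`, which is at least `3` for `k ≥ 16`. Then `K * (K + 1) + 1 ≤ (K + 1) ^ 2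
  -- ≤ k`, and padding fills the gap. Moreover `k < (K + 2) ^ 2 ≤ (K + 2) ^ 3`, so the exponent is
  -- at most `(K + 2) / 4 ≤ K - 1`. The passage to the cube is generous.
  · refine ⟨1 / 4, by norm_num, 16, fun k hk h => ?_⟩
    have hs : 4 ≤ k.sqrt := Nat.le_sqrt.2 hk
    obtain ⟨K, hK⟩ := Nat.exists_eq_add_of_le' (show 1 ≤ k.sqrt by omega)
    have hle := k.sqrt_le
    have hlt := k.lt_succ_sqrt
    rw [hK] at hs hle hlt
    obtain ⟨p, hp⟩ := Nat.exists_eq_add_of_le (show K * (K + 1) + 1 ≤ k by nlinarith)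
    have hcube : (k : ℝ) ^ (1 / 3 : ℝ) ≤ K + 2 := by
      have h3 : (k : ℝ) ≤ ((K : ℝ) + 2) ^ (3 : ℝ) := by
        rw [show (3 : ℝ) = ((3 : ℕ) : ℝ) by norm_num, Real.rpow_natCast]
        have : k ≤ (K + 2) ^ 3 := by
          refine hlt.le.trans ?_
          rw [Nat.succ_eq_add_one, ← pow_two]
          exact Nat.pow_le_pow_right (by omega) (by omega)
        exact_mod_cast this
      refine (Real.rpow_le_rpow (Nat.cast_nonneg k) h3 (by norm_num)).trans_eq ?_
      rw [← Real.rpow_mul (by positivity)]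
      norm_num
    have hK3 : (3 : ℝ) ≤ K := by exact_mod_cast (show 3 ≤ K by omega)
    rw [show k = K * (K + 1) + p + 1 by omega] at h hcube
    exact hOV K (by omega) 1 one_pos (ovSolvableWithSaving_of_reachability (by omega)
      (by linarith) h)
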